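/- Let $d\ge 1$, $a\le b$, $\beta>0$, and let $\omega=(\omega_t)_{t\in[a,b]}$ be an $\mathbb{R}^d$-valued stochastic process with continuous paths on a probability space. For $s,t\in[a,b]$ let $\nu_{st}$ be the law of $\omega_{st}=\omega_t-\omega_s$, and write $\|\nu_{st}\|_{C^\beta}$ for the $C^\beta(\mathbb{R}^d)$-Hölder norm of the density of $\nu_{st}$ with respect to Lebesgue measure ($+\infty$ if $\nu_{st}$ has no density of class $C^\beta$). Suppose that there is a finite constant $C_\nu$ such that for every interval $J\subseteq[a,b]$ $$\iint_{J\times J}\|\nu_{st}\|_{C^\beta}\,ds\,dt\le C_\nu|J| .$$ For a finite signed measure $\mu$ on $\mathbb{R}^d$ put $F_\mu(r,y)=\mu(\{x:|x-y|\le r\})$, and define operators on functions of $r>0$ by $\Delta_0F(r)=F(r)-F(r/2)$ and $\Delta_{k+1}F(r)=\Delta_kF(r)-2^{k+1}\Delta_kF(r/2)$. For $\alpha>0$ and $1\le p,q\le\infty$ let, with $k=\lceil\alpha+d-1\rceil$, $$\|\mu\|_{\mathrm{SBE}^{\alpha,p}_q}=\big\|\,r^{-\alpha-d}(\Delta_k)_rF_\mu(r,y)\,\big\|_{L^q_yL^p_r(\mathbb{R}^d\times\mathbb{R}^+,\,dy\otimes\frac{dr}{r})},$$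 and let $\mathrm{SBE}^{\alpha,p}_q$ be the set of compactly supported $\mu$ for which this is finite. For $a\le t\le b$ let $\mu_{a,t}=\int_a^t\delta_{\omega_r}\,dr$ be the occupation measure of $\omega$. Then for every $\alpha$ with $0<\alpha<\beta/2$ and $2\alpha\notin\mathbb{N}$, almost surely, for every $0<\gamma<\dfrac{\beta-2\alpha}{2(\beta+2d)}$ the map $t\mapsto\mu_{a,t}$ is $\gamma$-Hölder continuous on $[a,b]$ with values in $\mathrm{SBE}^{\alpha,2}_2$; that is, $\mu_{a,t}\in\mathrm{SBE}^{\alpha,2}_2$ for all $t\in[a,b]$, and there is a (random) finite constant $C$ with $\|\mu_{a,t}-\mu_{a,s}\|_{\mathrm{SBE}^{\alpha,2}_2}\le C|t-s|^\gamma$ for all $s,t\in[a,b]$. -/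

import Mathlib

open MeasureTheory Set
open scoped ENNReal NNReal

noncomputable section

/-- Hölder norm `‖f‖_{C^β}` of `f : E → ℝ`, with values in `[0,∞]`: with `n = ⌊β⌋` and `θ = β - n`,
it is `∑_{j ≤ n} sup ‖D^j f‖ + sup_{x ≠ y} ‖D^n f(x) - D^n f(y)‖ / |x - y|^θ`, and it is `∞` when
`f` is not `n` times continuously differentiable. (The terms `x = y` of the supremum are
`0 / _ = 0`; for integer `β` the last term is at most twice the supremum of `‖D^n f‖`, so this
is the usual `C^n` norm up to a factor.) -/
def holderENorm {E : Type*} [NormedAddCommGroup E] [NormedSpace ℝ E]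
    (β : ℝ) (f : E → ℝ) : ℝ≥0∞ :=
  ⨅ (_ : ContDiff ℝ (⌊β⌋₊ : ℕ) f),
    (∑ j ∈ Finset.range (⌊β⌋₊ + 1), ⨆ x : E, ‖iteratedFDeriv ℝ j f x‖ₑ) +
      ⨆ (x : E) (y : E),
        ‖iteratedFDeriv ℝ ⌊β⌋₊ f x - iteratedFDeriv ℝ ⌊β⌋₊ f y‖ₑ / edist x y ^ (β - ⌊β⌋₊)

/-- `‖ν‖_{C^β}` for a positive measure `ν` on `ℝ^d`: the Hölder norm of its (unique) continuous
Lebesgue density, and `∞` if there is no density of class `C^β`. -/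
def measureHolderENorm {d : ℕ} (β : ℝ) (ν : Measure (EuclideanSpace ℝ (Fin d))) : ℝ≥0∞ :=
  ⨅ (f : EuclideanSpace ℝ (Fin d) → ℝ) (_ : ∀ x, 0 ≤ f x)
    (_ : ν = volume.withDensity fun x => ENNReal.ofReal (f x)), holderENorm β f

/-- The operators `Δ_0 F(r) = F(r) - F(r/2)`, `Δ_{k+1} F(r) = Δ_k F(r) - 2^{k+1} Δ_k F(r/2)`. -/
def sbeDelta : ℕ → (ℝ → ℝ) → ℝ → ℝ
  | 0, F, r => F r - F (r / 2)
  | k + 1, F, r => sbeDelta k F r - 2 ^ (k + 1) * sbeDelta k F (r / 2)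

/-- The measure `dr / r` on `(0,∞)`. -/
def radialMeasure : Measure ℝ :=
  (volume.restrict (Ioi 0)).withDensity fun r => ENNReal.ofReal r⁻¹

/-- `F_μ(r, y) = μ {x : |x - y| ≤ r}`. -/
def ballMass {d : ℕ} (μ : SignedMeasure (EuclideanSpace ℝ (Fin d)))
    (r : ℝ) (y : EuclideanSpace ℝ (Fin d)) : ℝ :=
  μ (Metric.closedBall y r)

/-- `‖μ‖_{SBE^{α,p}_q} = ‖ r^{-α-d} (Δ_k)_r F_μ(r, y) ‖_{L^q_y L^p_r(dy ⊗ dr/r)}` with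
`k = ⌈α + d - 1⌉`. It is defined on signed measures, so that it applies to differences. -/
def sbeENorm {d : ℕ} (α : ℝ) (p q : ℝ≥0∞)
    (μ : SignedMeasure (EuclideanSpace ℝ (Fin d))) : ℝ≥0∞ :=
  eLpNorm
    (fun y : EuclideanSpace ℝ (Fin d) =>
      eLpNorm (fun r : ℝ =>
        r ^ (-α - d) * sbeDelta ⌈α + d - 1⌉₊ (fun ρ => ballMass μ ρ y) r) p radialMeasure)
    q volume

/-- Membership in `SBE^{α,p}_q`: the measure is compactly supported and its norm is finite. -/
def MemSBE {d : ℕ} (α : ℝ) (p q : ℝ≥0∞)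
    (μ : SignedMeasure (EuclideanSpace ℝ (Fin d))) : Prop :=
  (∃ K : Set (EuclideanSpace ℝ (Fin d)), IsCompact K ∧
    ∀ A : Set (EuclideanSpace ℝ (Fin d)), Disjoint A K → μ A = 0) ∧
  sbeENorm α p q μ < ∞

/-- `m` is `γ`-Hölder continuous on `[a,b]` with values in `SBE^{α,p}_q`. -/
def HolderInSBE {d : ℕ} (α : ℝ) (p q : ℝ≥0∞) (γ a b : ℝ)
    (m : ℝ → SignedMeasure (EuclideanSpace ℝ (Fin d))) : Prop :=
  (∀ t ∈ Icc a b, MemSBE α p q (m t)) ∧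
  ∃ C : ℝ≥0, ∀ s ∈ Icc a b, ∀ t ∈ Icc a b,
    sbeENorm α p q (m t - m s) ≤ C * ENNReal.ofReal (|t - s| ^ γ)

/-- The occupation measure `μ_{s,t} = ∫_s^t δ_{w(r)} dr` of a path `w`, for `s ≤ t`. -/
def occupationMeasure {d : ℕ} (w : ℝ → EuclideanSpace ℝ (Fin d)) (s t : ℝ) :
    Measure (EuclideanSpace ℝ (Fin d)) :=
  (volume.restrict (Ioc s t)).map w

instance {d : ℕ} (w : ℝ → EuclideanSpace ℝ (Fin d)) (s t : ℝ) :
    IsFiniteMeasure (occupationMeasure w s t) := by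
  unfold occupationMeasure
  infer_instance

end

/-! ### The operators `sbeDelta` as finite linear combinations of dilations -/

/-! The proof is a second moment estimate for `occShell`, the difference operator applied to ball
masses of the occupation measure, followed by a Kolmogorov argument. Write h for the length of the
time interval.

Squaring `occShell` gives a double time integral. Integrating the product of two kernels over space
and taking expectation leaves only the law ν of the increment: one kernel is integrated against a
difference of ball masses of ν (`integral_shellKernel_mul_eq`). A difference of order k annihilates
polynomials of degree at most k, so for k ≥ d + ⌊β⌋ Taylor expansion of the density along rays
bounds that difference by r^(d+β) ‖ν‖. The support of the other kernel contributes r^d, and the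
hypothesis on ν bounds the energy at scale r by r^(2d+β) h. Ignoring cancellation, it is also at
most r^d h².

The norm uses k = ⌈α+d-1⌉, which may be smaller than d + ⌊β⌋. Reading the recursion for the
differences backwards expresses order k at scale r through orders k and k+1 at scale 2r, with gain
2^(-(k+1)). In the weighted radial integral this is a strict contraction as soon as α + d < k + 1,
so a Hardy type absorption (`setLIntegral_Ioi_zero_le_of_dilation`) raises the order as far as
needed. The assumption 2α ∉ ℕ makes that inequality strict.

Using the first energy bound at small scales and the second at large ones gives E‖μ_{c,e}‖² ≤ C
(e-c)^(1+ρ) with ρ = (β-2α)/(β+d). Dyadic chaining then gives every Hölder exponent below ρ/2, a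
range containing the one claimed. -/

theorem exists_sbeDelta_eq_sum (k : ℕ) : ∃ c : ℕ → ℝ, ∀ (F : ℝ → ℝ) (r : ℝ),
    sbeDelta k F r = ∑ j ∈ Finset.range (k + 2), c j * F (r / 2 ^ j) := by
  induction k with
  | zero =>
    refine ⟨fun j => if j = 0 then 1 else -1, fun F r => ?_⟩
    simp [sbeDelta, Finset.sum_range_succ]
    ring
  | succ k ih =>
    obtain ⟨c, hc⟩ := ih
    refine ⟨fun j => (if j < k + 2 then c j else 0) -
      2 ^ (k + 1) * (if j = 0 then 0 else c (j - 1)), fun F r => ?_⟩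
    have h1 : ∑ j ∈ Finset.range (k + 3), (if j < k + 2 then c j else 0) * F (r / 2 ^ j) =
        sbeDelta k F r := by
      rw [Finset.sum_range_succ, hc]
      simp only [lt_irrefl, if_false, zero_mul, add_zero]
      exact Finset.sum_congr rfl fun j hj => by rw [if_pos (Finset.mem_range.1 hj)]
    have h2 : ∑ j ∈ Finset.range (k + 3), (if j = 0 then 0 else c (j - 1)) * F (r / 2 ^ j) =
        sbeDelta k F (r / 2) := by
      rw [Finset.sum_range_succ', hc]
      simp only [if_true, zero_mul, add_zero]
      refine Finset.sum_congr rfl fun j _ => ?_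
      rw [if_neg (Nat.succ_ne_zero j), Nat.add_sub_cancel, pow_succ', div_div]
    rw [sbeDelta, ← h1, ← h2, Finset.mul_sum, ← Finset.sum_sub_distrib]
    exact Finset.sum_congr rfl fun j _ => by ring

/-- The coefficients of `sbeDelta k` in terms of dyadic dilations. -/
noncomputable def sbeCoeff (k : ℕ) : ℕ → ℝ := (exists_sbeDelta_eq_sum k).choose

theorem sbeDelta_eq_sum (k : ℕ) (F : ℝ → ℝ) (r : ℝ) :
    sbeDelta k F r = ∑ j ∈ Finset.range (k + 2), sbeCoeff k j * F (r / 2 ^ j) :=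
  (exists_sbeDelta_eq_sum k).choose_spec F r

/-- A bound for `sbeDelta k` as an operator on bounded functions. -/
noncomputable def sbeBound (k : ℕ) : ℝ := ∑ j ∈ Finset.range (k + 2), |sbeCoeff k j|

theorem sbeBound_nonneg (k : ℕ) : 0 ≤ sbeBound k := Finset.sum_nonneg fun _ _ => abs_nonneg _

theorem abs_sbeDelta_le (k : ℕ) {F : ℝ → ℝ} {r B : ℝ} (hr : 0 < r)
    (hF : ∀ ρ, 0 < ρ → ρ ≤ r → |F ρ| ≤ B) : |sbeDelta k F r| ≤ sbeBound k * B := by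
  rw [sbeDelta_eq_sum, sbeBound, Finset.sum_mul]
  refine (Finset.abs_sum_le_sum_abs _ _).trans (Finset.sum_le_sum fun j _ => ?_)
  rw [abs_mul]
  exact mul_le_mul_of_nonneg_left
    (hF _ (by positivity) (div_le_self hr.le (one_le_pow₀ one_le_two))) (abs_nonneg _)

theorem sbeDelta_sub (k : ℕ) (F G : ℝ → ℝ) (r : ℝ) :
    sbeDelta k (fun ρ => F ρ - G ρ) r = sbeDelta k F r - sbeDelta k G r := by
  simp only [sbeDelta_eq_sum, ← Finset.sum_sub_distrib, mul_sub]

theorem sbeDelta_sum_mul {ι : Type*} (s : Finset ι) (k : ℕ) (F : ι → ℝ → ℝ) (b : ι → ℝ) (r : ℝ) :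
    sbeDelta k (fun ρ => ∑ i ∈ s, b i * F i ρ) r = ∑ i ∈ s, b i * sbeDelta k (F i) r := by
  simp only [sbeDelta_eq_sum, Finset.mul_sum]
  rw [Finset.sum_comm]
  exact Finset.sum_congr rfl fun i _ => Finset.sum_congr rfl fun j _ => by ring

theorem sbeDelta_congr (k : ℕ) {F G : ℝ → ℝ} {r : ℝ} (hr : 0 < r)
    (h : ∀ ρ, 0 < ρ → F ρ = G ρ) : sbeDelta k F r = sbeDelta k G r := by
  simp only [sbeDelta_eq_sum]
  exact Finset.sum_congr rfl fun j _ => by rw [h _ (by positivity)]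

theorem sbeDelta_integral {X : Type*} [MeasurableSpace X] (m : Measure X) (k : ℕ)
    {G : ℝ → X → ℝ} (hG : ∀ ρ, 0 < ρ → Integrable (G ρ) m) {r : ℝ} (hr : 0 < r) :
    sbeDelta k (fun ρ => ∫ x, G ρ x ∂m) r = ∫ x, sbeDelta k (fun ρ => G ρ x) r ∂m := by
  simp only [sbeDelta_eq_sum]
  rw [integral_finsetSum _ fun j _ => (hG _ (by positivity)).const_mul _]
  exact Finset.sum_congr rfl fun j _ => (integral_const_mul _ _).symm

/-- Halving the argument multiplies a monomial of degree n by 2^(-n), so stage j of the recursion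
contributes the factor 1 - 2^(j-n). The weights in the recursion are chosen so that stage n kills
degree n. -/
theorem sbeDelta_pow (k n : ℕ) (r : ℝ) :
    sbeDelta k (fun ρ => ρ ^ n) r = (∏ j ∈ Finset.range (k + 1), (1 - 2 ^ j / 2 ^ n)) * r ^ n := by
  induction k generalizing r with
  | zero => simp [sbeDelta, div_pow]; ring
  | succ k ih =>
    rw [sbeDelta, ih, ih, Finset.prod_range_succ _ (k + 1), div_pow]
    ring

theorem sbeDelta_pow_eq_zero {k n : ℕ} (h : n ≤ k) (r : ℝ) :
    sbeDelta k (fun ρ => ρ ^ n) r = 0 := by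
  rw [sbeDelta_pow, Finset.prod_eq_zero (Finset.mem_range.2 (Nat.lt_succ_of_le h)), zero_mul]
  simp

/-- `sbeDelta k` annihilates polynomials of degree at most `k`, hence is controlled by the
distance to them. -/
theorem abs_sbeDelta_pow_mul_le {k d n : ℕ} (hk : d + n ≤ k) {g : ℝ → ℝ} (b : ℕ → ℝ) {r B : ℝ}
    (hr : 0 < r)
    (hg : ∀ ρ, 0 < ρ → ρ ≤ r → |g ρ - ∑ j ∈ Finset.range (n + 1), b j * ρ ^ j| ≤ B) :
    |sbeDelta k (fun ρ => ρ ^ d * g ρ) r| ≤ sbeBound k * (r ^ d * B) := by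
  have h0 : sbeDelta k (fun ρ => ∑ j ∈ Finset.range (n + 1), b j * ρ ^ (d + j)) r = 0 := by
    rw [sbeDelta_sum_mul _ _ fun j ρ => ρ ^ (d + j)]
    refine Finset.sum_eq_zero fun j hj => ?_
    rw [sbeDelta_pow_eq_zero, mul_zero]
    have := Finset.mem_range.1 hj
    omega
  rw [← sub_zero (sbeDelta k _ r), ← h0, ← sbeDelta_sub]
  refine abs_sbeDelta_le k hr fun ρ h1 h2 => ?_
  have : ρ ^ d * g ρ - ∑ j ∈ Finset.range (n + 1), b j * ρ ^ (d + j) =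
      ρ ^ d * (g ρ - ∑ j ∈ Finset.range (n + 1), b j * ρ ^ j) := by
    rw [mul_sub, Finset.mul_sum]
    congr 1
    exact Finset.sum_congr rfl fun j _ => by ring
  rw [this, abs_mul, abs_of_pos (by positivity)]
  gcongr
  exact hg ρ h1 h2

/-! ### The kernel of the difference operator on ball indicators -/

/-- `sbeDelta k` applied in `ρ` to the indicator of `‖z‖ ≤ ρ`. -/
noncomputable def shellKernel {E : Type*} [NormedAddCommGroup E] (k : ℕ) (r : ℝ) (z : E) : ℝ :=
  sbeDelta k (fun ρ => if ‖z‖ ≤ ρ then 1 else 0) r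

section Kernel

variable {E : Type*} [NormedAddCommGroup E]

theorem abs_shellKernel_le (k : ℕ) {r : ℝ} (hr : 0 < r) (z : E) :
    |shellKernel k r z| ≤ (Metric.closedBall (0 : E) r).indicator (fun _ => sbeBound k) z := by
  have : ∀ ρ, 0 < ρ → ρ ≤ r → |(if ‖z‖ ≤ ρ then 1 else 0 : ℝ)| ≤ if ‖z‖ ≤ r then 1 else 0 := by
    intro ρ _ h
    split_ifs with h1 h2 <;> simp
    exact absurd (h1.trans h) h2
  refine (abs_sbeDelta_le k hr this).trans (le_of_eq ?_)
  by_cases h : ‖z‖ ≤ r <;> simp [h]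

theorem abs_shellKernel_le_bound (k : ℕ) (r : ℝ) (z : E) :
    |shellKernel k r z| ≤ sbeBound k := by
  rw [shellKernel, sbeDelta_eq_sum, sbeBound]
  refine (Finset.abs_sum_le_sum_abs _ _).trans (Finset.sum_le_sum fun j _ => ?_)
  rw [abs_mul]
  refine mul_le_of_le_one_right (abs_nonneg _) ?_
  split_ifs <;> simp

theorem measurable_shellKernel [MeasurableSpace E] [OpensMeasurableSpace E] (k : ℕ) :
    Measurable fun p : ℝ × E => shellKernel k p.1 p.2 := by
  simp only [shellKernel, sbeDelta_eq_sum]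
  refine Finset.measurable_fun_sum _ fun j _ => Measurable.const_mul ?_ _
  exact Measurable.ite (measurableSet_le (by fun_prop) (by fun_prop)) measurable_const
    measurable_const

/-- The defining recursion solved for its dilated term. The factor 2^(-(k+1)) is the gain that later
permits raising the order of the differences. -/
theorem shellKernel_succ (k : ℕ) (r : ℝ) (z : E) :
    shellKernel k r z = (2 ^ (k + 1))⁻¹ * (shellKernel k (2 * r) z - shellKernel (k + 1) (2 * r) z) := by
  have : shellKernel (k + 1) (2 * r) z =
      shellKernel k (2 * r) z - 2 ^ (k + 1) * shellKernel k (2 * r / 2) z := rfl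
  rw [this, mul_div_cancel_left₀ r two_ne_zero]
  field_simp
  ring

end Kernel

/-! ### Taylor expansion along rays and densities of Hölder class -/

theorem iteratedDeriv_comp_line {E : Type*} [NormedAddCommGroup E] [NormedSpace ℝ E] {n : ℕ}
    {f : E → ℝ} (hf : ContDiff ℝ n f) (w x : E) (t : ℝ) :
    iteratedDeriv n (fun s : ℝ => f (w + s • x)) t =
      iteratedFDeriv ℝ n f (w + t • x) (fun _ => x) := by
  have h : (fun s : ℝ => f (w + s • x)) =
      (fun y => f (w + y)) ∘ (ContinuousLinearMap.toSpanSingleton ℝ x) := by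
    ext s; simp
  rw [iteratedDeriv_eq_iteratedFDeriv, h,
    ContinuousLinearMap.iteratedFDeriv_comp_right (n := n) _ (by fun_prop) _ le_rfl,
    iteratedFDeriv_comp_add_left]
  simp

/-- The Lagrange remainder of degree n - 1 involves the n-th derivative at an intermediate point;
subtracting the n-th Taylor term leaves an oscillation of that derivative. Hence n derivatives
suffice. Degree 0 has no such remainder and is immediate. -/
theorem abs_sub_taylor_le {n : ℕ} {g : ℝ → ℝ} (hg : ContDiff ℝ n g) {ρ M : ℝ} (hρ : 0 < ρ)
    (hM : ∀ t, 0 ≤ t → t ≤ ρ → |iteratedDeriv n g t - iteratedDeriv n g 0| ≤ M) :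
    |g ρ - ∑ j ∈ Finset.range (n + 1), (iteratedDeriv j g 0 / j.factorial) * ρ ^ j| ≤
      M * ρ ^ n := by
  rcases n with _ | m
  · simpa using hM ρ hρ.le le_rfl
  · have hM0 : 0 ≤ M := (abs_nonneg _).trans (hM 0 le_rfl hρ.le)
    obtain ⟨ξ, hξ, h⟩ := taylor_mean_remainder_lagrange_iteratedDeriv (f := g) (n := m) hρ.ne
      (hg.contDiffOn.mono (subset_univ _))
    have hT : taylorWithinEval g m (uIcc 0 ρ) 0 ρ =
        ∑ j ∈ Finset.range (m + 1), (iteratedDeriv j g 0 / j.factorial) * ρ ^ j := by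
      rw [taylor_within_apply]
      refine Finset.sum_congr rfl fun j hj => ?_
      have hj' : (j : WithTop ℕ∞) ≤ ((m + 1 : ℕ) : WithTop ℕ∞) := by
        have := Finset.mem_range.1 hj
        exact_mod_cast this.le
      rw [iteratedDerivWithin_eq_iteratedDeriv (uniqueDiffOn_uIcc hρ.ne)
        (hg.of_le hj').contDiffAt left_mem_uIcc, smul_eq_mul, sub_zero]
      ring
    rw [hT] at h
    rw [uIoo_of_lt hρ] at hξ
    have h2 : g ρ - ∑ j ∈ Finset.range (m + 1 + 1), (iteratedDeriv j g 0 / j.factorial) * ρ ^ j =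
        (iteratedDeriv (m + 1) g ξ - iteratedDeriv (m + 1) g 0) * (ρ ^ (m + 1) /
          (m + 1).factorial) := by
      rw [Finset.sum_range_succ, ← sub_sub, h]
      ring
    rw [h2, abs_mul, abs_of_nonneg (a := ρ ^ (m + 1) / _) (by positivity)]
    refine mul_le_mul (hM ξ hξ.1.le hξ.2.le) (div_le_self (by positivity) ?_) (by positivity) hM0
    exact_mod_cast (Nat.factorial_pos _)

theorem contDiff_of_holderENorm_ne_top {E : Type*} [NormedAddCommGroup E] [NormedSpace ℝ E]
    {β : ℝ} {f : E → ℝ} (h : holderENorm β f ≠ ∞) : ContDiff ℝ (⌊β⌋₊ : ℕ) f := by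
  by_contra hn
  exact h (by simp [holderENorm, hn])

theorem norm_iteratedFDeriv_sub_le {E : Type*} [NormedAddCommGroup E] [NormedSpace ℝ E]
    {β : ℝ} {f : E → ℝ} (h : holderENorm β f ≠ ∞) (x y : E) :
    ‖iteratedFDeriv ℝ ⌊β⌋₊ f x - iteratedFDeriv ℝ ⌊β⌋₊ f y‖ ≤
      (holderENorm β f).toReal * dist x y ^ (β - ⌊β⌋₊) := by
  rcases eq_or_ne x y with rfl | hxy
  · rw [sub_self, norm_zero]; positivity
  have hpos : 0 < dist x y := dist_pos.2 hxy
  have h1 : ‖iteratedFDeriv ℝ ⌊β⌋₊ f x - iteratedFDeriv ℝ ⌊β⌋₊ f y‖ₑ /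
      edist x y ^ (β - ⌊β⌋₊) ≤ holderENorm β f := by
    rw [holderENorm, iInf_pos (contDiff_of_holderENorm_ne_top h)]
    exact (le_iSup₂ (f := fun x y => ‖iteratedFDeriv ℝ ⌊β⌋₊ f x - iteratedFDeriv ℝ ⌊β⌋₊ f y‖ₑ /
      edist x y ^ (β - ⌊β⌋₊)) x y).trans le_add_self
  have he : edist x y ^ (β - ⌊β⌋₊) = ENNReal.ofReal (dist x y ^ (β - ⌊β⌋₊)) := by
    rw [edist_dist, ENNReal.ofReal_rpow_of_pos hpos]
  have hp2 : 0 < dist x y ^ (β - ⌊β⌋₊) := Real.rpow_pos_of_pos hpos _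
  rw [he, ENNReal.div_le_iff (by simpa using hp2) ENNReal.ofReal_ne_top] at h1
  have h2 := ENNReal.toReal_mono (ENNReal.mul_ne_top h ENNReal.ofReal_ne_top) h1
  rwa [toReal_enorm, ENNReal.toReal_mul, ENNReal.toReal_ofReal hp2.le] at h2

/-- Multiplied by ρ^d, the Taylor polynomial of degree ⌊β⌋ along the ray has degree at most k and is
annihilated; Hölder continuity of the top derivative bounds the remainder. -/
theorem abs_sbeDelta_ray_le {E : Type*} [NormedAddCommGroup E] [NormedSpace ℝ E] {β : ℝ}
    (hβ : 0 ≤ β) {f : E → ℝ} (h : holderENorm β f ≠ ∞) {k d : ℕ} (hk : d + ⌊β⌋₊ ≤ k) (w : E)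
    {x : E} (hx : ‖x‖ ≤ 1) {r : ℝ} (hr : 0 < r) :
    |sbeDelta k (fun ρ => ρ ^ d * f (w + ρ • x)) r| ≤
      sbeBound k * ((holderENorm β f).toReal * r ^ (d + β)) := by
  set n := ⌊β⌋₊ with hn
  set S := (holderENorm β f).toReal with hS
  have hf := contDiff_of_holderENorm_ne_top h
  have hθ : 0 ≤ β - n := sub_nonneg.2 (Nat.floor_le hβ)
  have key := abs_sbeDelta_pow_mul_le (k := k) (d := d) (n := n) hk
    (g := fun ρ => f (w + ρ • x))
    (fun j => iteratedDeriv j (fun ρ : ℝ => f (w + ρ • x)) 0 / j.factorial)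
    (B := S * r ^ β) hr ?_
  · refine key.trans (le_of_eq ?_)
    rw [Real.rpow_add hr, Real.rpow_natCast]
    ring
  · intro ρ h0 hρ
    refine (abs_sub_taylor_le (n := n) (g := fun ρ => f (w + ρ • x)) (M := S * ρ ^ (β - n))
      (by fun_prop) h0 fun t ht0 ht => ?_).trans ?_
    · rw [iteratedDeriv_comp_line hf, iteratedDeriv_comp_line hf,
        ← sub_apply, ← Real.norm_eq_abs]
      refine (ContinuousMultilinearMap.le_opNorm _ _).trans ?_
      have h1 : ∏ _i : Fin n, ‖x‖ ≤ 1 := by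
        simpa using pow_le_one₀ (norm_nonneg x) hx
      refine (mul_le_of_le_one_right (norm_nonneg _) h1).trans
        ((norm_iteratedFDeriv_sub_le h _ _).trans ?_)
      refine mul_le_mul_of_nonneg_left ?_ ENNReal.toReal_nonneg
      refine Real.rpow_le_rpow dist_nonneg ?_ hθ
      rw [dist_eq_norm]
      simp only [zero_smul, add_zero, add_sub_cancel_left]
      rw [norm_smul, Real.norm_of_nonneg ht0]
      nlinarith [norm_nonneg x]
    · rw [mul_assoc, ← Real.rpow_natCast ρ, ← Real.rpow_add h0, sub_add_cancel]
      gcongr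

/-- Rescaling to the unit ball frees the domain of ρ, so that differences in ρ can be taken under
the integral. -/
theorem setIntegral_closedBall_eq {d : ℕ} (f : EuclideanSpace ℝ (Fin d) → ℝ)
    (w : EuclideanSpace ℝ (Fin d)) {ρ : ℝ} (hρ : 0 < ρ) :
    ∫ z in Metric.closedBall w ρ, f z =
      ∫ x in Metric.closedBall (0 : EuclideanSpace ℝ (Fin d)) 1, ρ ^ d * f (w + ρ • x) := by
  rw [integral_const_mul,
    Measure.setIntegral_comp_smul_of_pos volume (fun x => f (w + x)) _ hρ,
    finrank_euclideanSpace_fin, smul_unitClosedBall, smul_eq_mul, mul_inv_cancel_left₀ (by positivity),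
    Real.norm_of_nonneg hρ.le]
  have := (measurePreserving_add_left (volume : Measure (EuclideanSpace ℝ (Fin d))) w).setIntegral_preimage_emb
    (measurableEmbedding_addLeft w) f (Metric.closedBall w ρ)
  rw [← this]
  simp

/-- Iterated differences in the radius of the mass of balls see the Hölder regularity of the
density. -/
theorem enorm_sbeDelta_measureReal_closedBall_le (d : ℕ) {β : ℝ} (hβ : 0 ≤ β) {k : ℕ}
    (hk : d + ⌊β⌋₊ ≤ k) : ∃ C : ℝ≥0, ∀ (ν : Measure (EuclideanSpace ℝ (Fin d)))
      (w : EuclideanSpace ℝ (Fin d)) (r : ℝ), 0 < r →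
    ‖sbeDelta k (fun ρ => ν.real (Metric.closedBall w ρ)) r‖ₑ ≤
      C * ENNReal.ofReal (r ^ (d + β)) * measureHolderENorm β ν := by
  set B := Metric.closedBall (0 : EuclideanSpace ℝ (Fin d)) 1 with hB
  have hBvol : volume B < ∞ := measure_closedBall_lt_top
  -- The added 1 keeps the constant nonzero, so that it can be moved inside the infima over
  -- densities and the case of infinite norm is trivial.
  refine ⟨(sbeBound k * volume.real B).toNNReal + 1, fun ν w r hr => ?_⟩
  have hr' : 0 < r ^ (d + β) := Real.rpow_pos_of_pos hr _
  have hc : (((sbeBound k * volume.real B).toNNReal + 1 : ℝ≥0) : ℝ≥0∞) *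
      ENNReal.ofReal (r ^ (d + β)) ≠ 0 := by simp [hr']
  have hc' : (((sbeBound k * volume.real B).toNNReal + 1 : ℝ≥0) : ℝ≥0∞) *
      ENNReal.ofReal (r ^ (d + β)) ≠ ∞ := ENNReal.mul_ne_top ENNReal.coe_ne_top ENNReal.ofReal_ne_top
  rw [measureHolderENorm, ENNReal.mul_iInf_of_ne hc hc']
  refine le_iInf fun f => ?_
  rw [ENNReal.mul_iInf_of_ne hc hc']
  refine le_iInf fun hf0 => ?_
  rw [ENNReal.mul_iInf_of_ne hc hc']
  refine le_iInf fun hν => ?_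
  rcases eq_or_ne (holderENorm β f) ∞ with h | h
  · rw [h, ENNReal.mul_top hc]
    exact le_top
  have hcf : Continuous f := (contDiff_of_holderENorm_ne_top h).continuous
  have hmass : ∀ ρ, 0 < ρ → ν.real (Metric.closedBall w ρ) = ∫ x in B, ρ ^ d * f (w + ρ • x) := by
    intro ρ hρ
    rw [hB, ← setIntegral_closedBall_eq f w hρ, measureReal_def, hν,
      withDensity_apply _ Metric.isClosed_closedBall.measurableSet,
      integral_eq_lintegral_of_nonneg_ae (ae_of_all _ hf0) hcf.aestronglyMeasurable]
  have hint : ∀ ρ : ℝ, 0 < ρ → Integrable (fun x => ρ ^ d * f (w + ρ • x)) (volume.restrict B) :=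
    fun ρ _ => ContinuousOn.integrableOn_compact (isCompact_closedBall _ _) (by fun_prop)
  rw [sbeDelta_congr k hr hmass, sbeDelta_integral _ _ hint hr]
  have hle : ‖∫ x in B, sbeDelta k (fun ρ => ρ ^ d * f (w + ρ • x)) r‖ ≤
      sbeBound k * ((holderENorm β f).toReal * r ^ (d + β)) * volume.real B :=
    norm_setIntegral_le_of_norm_le_const hBvol fun x hx =>
      abs_sbeDelta_ray_le hβ h hk w (mem_closedBall_zero_iff.1 hx) hr
  rw [← ofReal_norm]
  refine (ENNReal.ofReal_le_ofReal hle).trans ?_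
  have h3 : sbeBound k * ((holderENorm β f).toReal * r ^ (d + β)) * volume.real B =
      (sbeBound k * volume.real B) * r ^ (d + β) * (holderENorm β f).toReal := by ring
  have h4 : 0 ≤ sbeBound k * volume.real B := mul_nonneg (sbeBound_nonneg k) measureReal_nonneg
  rw [h3, ENNReal.ofReal_mul (by positivity), ENNReal.ofReal_mul h4, ENNReal.ofReal_toReal h]
  gcongr
  rw [ENNReal.ofReal]
  push_cast
  exact le_self_add

/-! ### Second moments of the shell transform of the occupation measure -/

/-- The iterated difference in the radius of the occupation measure of `w` on `(s, t]`. -/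
noncomputable def occShell {d : ℕ} (k : ℕ) (w : ℝ → EuclideanSpace ℝ (Fin d)) (s t r : ℝ)
    (y : EuclideanSpace ℝ (Fin d)) : ℝ :=
  ∫ u in s..t, shellKernel k r (w u - y)

section SecondMoment

variable {Ω : Type*} [MeasurableSpace Ω] {P : Measure Ω} [IsProbabilityMeasure P] {d : ℕ}

theorem volume_closedBall_eq (w : EuclideanSpace ℝ (Fin d)) {r : ℝ} (hr : 0 < r) :
    volume (Metric.closedBall w r) = ENNReal.ofReal (r ^ (d : ℝ)) *
      volume (Metric.ball (0 : EuclideanSpace ℝ (Fin d)) 1) := by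
  rw [Measure.addHaar_closedBall _ _ hr.le, finrank_euclideanSpace_fin, Real.rpow_natCast]

theorem lintegral_enorm_le_of_le_indicator_closedBall
    {G : Ω × EuclideanSpace ℝ (Fin d) → ℝ} (hG : Measurable G)
    {T : Ω → EuclideanSpace ℝ (Fin d)} {b r : ℝ} (hr : 0 < r)
    (hb : ∀ q, |G q| ≤ (Metric.closedBall (T q.1) r).indicator (fun _ => b) q.2) :
    ∫⁻ q, ‖G q‖ₑ ∂(P.prod volume) ≤ ENNReal.ofReal b * (ENNReal.ofReal (r ^ (d : ℝ)) *
      volume (Metric.ball (0 : EuclideanSpace ℝ (Fin d)) 1)) := by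
  rw [lintegral_prod _ hG.enorm.aemeasurable]
  calc ∫⁻ x, ∫⁻ y, ‖G (x, y)‖ₑ ∂volume ∂P
      ≤ ∫⁻ x, ∫⁻ y, (Metric.closedBall (T x) r).indicator (fun _ => ENNReal.ofReal b) y ∂volume ∂P := by
        gcongr with x y
        rw [← ofReal_norm, Real.norm_eq_abs]
        refine (ENNReal.ofReal_le_ofReal (hb (x, y))).trans (le_of_eq ?_)
        by_cases h : y ∈ Metric.closedBall (T x) r
        · rw [indicator_of_mem h, indicator_of_mem h]
        · rw [indicator_of_notMem h, indicator_of_notMem h, ENNReal.ofReal_zero]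
    _ = _ := by
        simp only [lintegral_indicator_const Metric.isClosed_closedBall.measurableSet,
          volume_closedBall_eq _ hr, lintegral_const, measure_univ, mul_one]

theorem abs_shellKernel_mul_le (k : ℕ) {r : ℝ} (hr : 0 < r) (y z : EuclideanSpace ℝ (Fin d)) :
    |shellKernel k r y * shellKernel k r z| ≤
      (Metric.closedBall (0 : EuclideanSpace ℝ (Fin d)) r).indicator (fun _ => sbeBound k ^ 2) y := by
  rw [abs_mul]
  refine (mul_le_mul (abs_shellKernel_le k hr y) (abs_shellKernel_le_bound k r z)
    (abs_nonneg _) (indicator_nonneg (fun _ _ => sbeBound_nonneg k) _)).trans (le_of_eq ?_)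
  by_cases h : ‖y‖ ≤ r <;> simp [h, sq]

theorem measurable_shellKernel_right (k : ℕ) (r : ℝ) :
    Measurable (shellKernel k r : EuclideanSpace ℝ (Fin d) → ℝ) :=
  (measurable_shellKernel k).comp (measurable_const.prodMk measurable_id)

theorem measurable_shellKernel_mul {Θ : Type*} [MeasurableSpace Θ] (k : ℕ) (r : ℝ)
    {U V : Θ → EuclideanSpace ℝ (Fin d)} (hU : Measurable U) (hV : Measurable V) :
    Measurable fun q => shellKernel k r (U q) * shellKernel k r (V q) :=
  ((measurable_shellKernel_right k r).comp hU).mul ((measurable_shellKernel_right k r).comp hV)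

theorem lintegral_enorm_shellKernel_mul_le (k : ℕ) {r : ℝ} (hr : 0 < r)
    {U V : Ω → EuclideanSpace ℝ (Fin d)} (hU : Measurable U) (hV : Measurable V) :
    ∫⁻ q, ‖shellKernel k r (U q.1 - q.2) * shellKernel k r (V q.1 - q.2)‖ₑ ∂(P.prod volume) ≤
      ENNReal.ofReal (sbeBound k ^ 2) * (ENNReal.ofReal (r ^ (d : ℝ)) *
        volume (Metric.ball (0 : EuclideanSpace ℝ (Fin d)) 1)) := by
  refine lintegral_enorm_le_of_le_indicator_closedBall (T := U)
    (measurable_shellKernel_mul k r (by fun_prop) (by fun_prop)) hr fun q => ?_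
  refine (abs_shellKernel_mul_le k hr _ _).trans (le_of_eq ?_)
  have : U q.1 - q.2 ∈ Metric.closedBall (0 : EuclideanSpace ℝ (Fin d)) r ↔
      q.2 ∈ Metric.closedBall (U q.1) r := by
    rw [mem_closedBall_zero_iff, Metric.mem_closedBall, dist_comm, dist_eq_norm]
  by_cases h : q.2 ∈ Metric.closedBall (U q.1) r
  · rw [indicator_of_mem h, indicator_of_mem (this.2 h)]
  · rw [indicator_of_notMem h, indicator_of_notMem (mt this.1 h)]

theorem integrable_of_lintegral_le {X : Type*} [MeasurableSpace X] {m : Measure X} {G : X → ℝ}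
    {B : ℝ≥0∞} (hG : Measurable G) (hB : B < ∞) (h : ∫⁻ x, ‖G x‖ₑ ∂m ≤ B) : Integrable G m :=
  ⟨hG.aestronglyMeasurable, h.trans_lt hB⟩

theorem const_mul_volume_ball_lt_top (b s : ℝ) : ENNReal.ofReal b * (ENNReal.ofReal s *
    volume (Metric.ball (0 : EuclideanSpace ℝ (Fin d)) 1)) < ∞ :=
  ENNReal.mul_lt_top ENNReal.ofReal_lt_top
    (ENNReal.mul_lt_top ENNReal.ofReal_lt_top measure_ball_lt_top)

theorem integral_shellKernel_add_eq (k : ℕ) {r : ℝ} (hr : 0 < r)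
    {Z : Ω → EuclideanSpace ℝ (Fin d)} (hZ : Measurable Z) (w : EuclideanSpace ℝ (Fin d)) :
    ∫ x, shellKernel k r (Z x + w) ∂P =
      sbeDelta k (fun ρ => (P.map Z).real (Metric.closedBall (-w) ρ)) r := by
  have hS : ∀ ρ, MeasurableSet (Z ⁻¹' Metric.closedBall (-w) ρ) := fun ρ =>
    hZ Metric.isClosed_closedBall.measurableSet
  have h1 : ∀ ρ, (fun x => if ‖Z x + w‖ ≤ ρ then (1 : ℝ) else 0) =
      (Z ⁻¹' Metric.closedBall (-w) ρ).indicator (fun _ => 1) := by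
    intro ρ
    ext x
    by_cases h : ‖Z x + w‖ ≤ ρ <;> simp [h, dist_eq_norm]
  simp only [shellKernel]
  rw [← sbeDelta_integral (G := fun ρ x => if ‖Z x + w‖ ≤ ρ then (1 : ℝ) else 0)]
  · congr 1
    ext ρ
    rw [h1, integral_indicator_const _ (hS ρ), map_measureReal_apply hZ
      Metric.isClosed_closedBall.measurableSet]
    simp
  · intro ρ _
    simp only [h1]
    exact (integrable_const _).indicator (hS ρ)
  · exact hr

/-- Translating the space variable by U makes the randomness enter only through V - U. Fubini then
turns the expectation of the second kernel into differences of ball masses of the increment's law.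
-/
theorem integral_shellKernel_mul_eq (k : ℕ) {r : ℝ} (hr : 0 < r)
    {U V : Ω → EuclideanSpace ℝ (Fin d)} (hU : Measurable U) (hV : Measurable V) :
    ∫ q, shellKernel k r (U q.1 - q.2) * shellKernel k r (V q.1 - q.2) ∂(P.prod volume) =
      ∫ w, shellKernel k r w *
        sbeDelta k (fun ρ => (P.map fun x => V x - U x).real (Metric.closedBall (-w) ρ)) r := by
  rw [integral_prod _ (integrable_of_lintegral_le
    (measurable_shellKernel_mul k r (by fun_prop) (by fun_prop)) (const_mul_volume_ball_lt_top _ _)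
    (lintegral_enorm_shellKernel_mul_le k hr hU hV))]
  have h1 : ∀ x, ∫ y, shellKernel k r (U x - y) * shellKernel k r (V x - y) =
      ∫ w, shellKernel k r w * shellKernel k r ((V x - U x) + w) := by
    intro x
    rw [← integral_sub_left_eq_self
      (fun y => shellKernel k r (U x - y) * shellKernel k r (V x - y)) volume (U x)]
    refine integral_congr_ae (ae_of_all _ fun w => ?_)
    simp only [sub_sub_cancel]
    rw [show V x - (U x - w) = V x - U x + w by abel]
  simp only [h1]
  rw [integral_integral_swap]
  · refine integral_congr_ae (ae_of_all _ fun w => ?_)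
    simp only
    rw [integral_const_mul, integral_shellKernel_add_eq k hr (Z := fun x => V x - U x) (by fun_prop)]
  · refine integrable_of_lintegral_le (measurable_shellKernel_mul k r (by fun_prop) (by fun_prop))
      (const_mul_volume_ball_lt_top (sbeBound k ^ 2) (r ^ (d : ℝ)))
      (lintegral_enorm_le_of_le_indicator_closedBall (T := fun _ => 0)
      (measurable_shellKernel_mul k r (by fun_prop) (by fun_prop)) hr fun q => ?_)
    exact abs_shellKernel_mul_le k hr _ _

/-- One factor r^d is the volume of the kernel's support; the remaining r^(d+β) comes from the
regularity of the increment's law. -/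
theorem exists_enorm_integral_shellKernel_mul_le (d : ℕ) {β : ℝ} (hβ : 0 ≤ β) {k : ℕ}
    (hk : d + ⌊β⌋₊ ≤ k) : ∃ C : ℝ≥0, ∀ (U V : Ω → EuclideanSpace ℝ (Fin d)), Measurable U →
      Measurable V → ∀ r : ℝ, 0 < r →
    ‖∫ q, shellKernel k r (U q.1 - q.2) * shellKernel k r (V q.1 - q.2) ∂(P.prod volume)‖ₑ ≤
      C * ENNReal.ofReal (r ^ (2 * d + β)) * measureHolderENorm β (P.map fun x => V x - U x) := by
  obtain ⟨C, hC⟩ := enorm_sbeDelta_measureReal_closedBall_le d hβ hk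
  set v := volume (Metric.ball (0 : EuclideanSpace ℝ (Fin d)) 1) with hv
  have hvt : v ≠ ∞ := measure_ball_lt_top.ne
  refine ⟨(sbeBound k).toNNReal * v.toNNReal * C, fun U V hU hV r hr => ?_⟩
  rw [integral_shellKernel_mul_eq k hr hU hV]
  set M := measureHolderENorm β (P.map fun x => V x - U x)
  refine (enorm_integral_le_lintegral_enorm _).trans ?_
  calc ∫⁻ w, ‖shellKernel k r w *
        sbeDelta k (fun ρ => (P.map fun x => V x - U x).real (Metric.closedBall (-w) ρ)) r‖ₑ
      ≤ ∫⁻ w, (Metric.closedBall (0 : EuclideanSpace ℝ (Fin d)) r).indicator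
          (fun _ => ENNReal.ofReal (sbeBound k) * (C * ENNReal.ofReal (r ^ (d + β)) * M)) w := by
        gcongr with w
        rw [enorm_mul]
        have h1 := abs_shellKernel_le k hr w
        by_cases h : w ∈ Metric.closedBall (0 : EuclideanSpace ℝ (Fin d)) r
        · rw [indicator_of_mem h] at h1 ⊢
          refine mul_le_mul' ?_ (hC _ _ _ hr)
          rw [← ofReal_norm]
          exact ENNReal.ofReal_le_ofReal h1
        · rw [indicator_of_notMem h] at h1 ⊢
          rw [abs_nonpos_iff.1 h1]
          simp
    _ = _ := by
        rw [lintegral_indicator_const Metric.isClosed_closedBall.measurableSet,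
          volume_closedBall_eq _ hr, ← hv, show (2 * d + β : ℝ) = d + β + d by ring,
          Real.rpow_add hr _ (d : ℝ), ENNReal.ofReal_mul (by positivity), ENNReal.ofReal]
        push_cast
        rw [ENNReal.coe_toNNReal hvt]
        ring

/-- The second moment, integrated over space, of the shell transform of the occupation measure. -/
noncomputable def shellEnergy (P : Measure Ω) (X : ℝ → Ω → EuclideanSpace ℝ (Fin d)) (k : ℕ)
    (s t r : ℝ) : ℝ≥0∞ :=
  ∫⁻ q, ‖occShell k (fun u => X u q.1) s t r q.2‖ₑ ^ 2 ∂(P.prod volume)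

theorem measurable_uncurry_path {X : ℝ → Ω → EuclideanSpace ℝ (Fin d)}
    (hX : ∀ u, Measurable (X u)) (hc : ∀ x, Continuous fun u => X u x) :
    Measurable fun p : ℝ × Ω => X p.1 p.2 :=
  measurable_uncurry_of_continuous_of_measurable hc hX

/-- The squared time integral is a double integral. Absolute values are taken only after integrating
over space and probability, so the cancellation in those integrals survives. -/
theorem shellEnergy_le_lintegral {X : ℝ → Ω → EuclideanSpace ℝ (Fin d)}
    (hX : ∀ u, Measurable (X u)) (hc : ∀ x, Continuous fun u => X u x) (k : ℕ) {c e r : ℝ}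
    (hce : c ≤ e) (hr : 0 < r) :
    shellEnergy P X k c e r ≤ ∫⁻ p in Icc c e ×ˢ Icc c e,
      ‖∫ q, shellKernel k r (X p.1 q.1 - q.2) * shellKernel k r (X p.2 q.1 - q.2)
        ∂(P.prod volume)‖ₑ := by
  have hm := measurable_uncurry_path hX hc
  set l : Measure ℝ := volume.restrict (Ioc c e) with hl
  have : IsFiniteMeasure l := by rw [hl]; infer_instance
  obtain ⟨K, hKdef⟩ : ∃ K : (Ω × EuclideanSpace ℝ (Fin d)) → ℝ × ℝ → ℝ, ∀ q p, K q p =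
    shellKernel k r (X p.1 q.1 - q.2) * shellKernel k r (X p.2 q.1 - q.2) := ⟨_, fun _ _ => rfl⟩
  have hKm : Measurable (Function.uncurry K) := by
    simp only [Function.uncurry_def, hKdef]
    refine measurable_shellKernel_mul k r ?_ ?_
    · exact (hm.comp (f := fun z : (Ω × EuclideanSpace ℝ (Fin d)) × ℝ × ℝ => (z.2.1, z.1.1))
        (by fun_prop)).sub (by fun_prop)
    · exact (hm.comp (f := fun z : (Ω × EuclideanSpace ℝ (Fin d)) × ℝ × ℝ => (z.2.2, z.1.1))
        (by fun_prop)).sub (by fun_prop)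
  have hK : Integrable (Function.uncurry K) ((P.prod volume).prod (l.prod l)) := by
    refine integrable_of_lintegral_le (B := ∫⁻ _p : ℝ × ℝ, ENNReal.ofReal (sbeBound k ^ 2) *
      (ENNReal.ofReal (r ^ (d : ℝ)) * volume (Metric.ball (0 : EuclideanSpace ℝ (Fin d)) 1))
        ∂(l.prod l)) hKm ?_ ?_
    · rw [lintegral_const]
      exact ENNReal.mul_lt_top (const_mul_volume_ball_lt_top _ _) (measure_lt_top _ _)
    · rw [lintegral_prod_symm _ hKm.enorm.aemeasurable]
      refine lintegral_mono fun p => ?_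
      simp only [Function.uncurry_apply_pair, hKdef]
      exact lintegral_enorm_shellKernel_mul_le k hr (hX p.1) (hX p.2)
  have hsq : ∀ q : Ω × EuclideanSpace ℝ (Fin d),
      ∫ p, K q p ∂(l.prod l) = occShell k (fun u => X u q.1) c e r q.2 ^ 2 := by
    intro q
    rw [occShell, intervalIntegral.integral_of_le hce, sq, ← integral_prod_mul]
    simp only [hKdef, ← hl]
  have hint := hK.integral_prod_left
  simp only [Function.uncurry] at hint
  simp only [hsq] at hint
  calc shellEnergy P X k c e r
      = ∫⁻ q, ENNReal.ofReal (occShell k (fun u => X u q.1) c e r q.2 ^ 2) ∂(P.prod volume) := by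
        rw [shellEnergy]
        refine lintegral_congr fun q => ?_
        rw [← ofReal_norm, ← ENNReal.ofReal_pow (norm_nonneg _), Real.norm_eq_abs, sq_abs]
    _ = ENNReal.ofReal (∫ q, ∫ p, K q p ∂(l.prod l) ∂(P.prod volume)) := by
        simp only [hsq]
        exact (ofReal_integral_eq_lintegral_ofReal hint (ae_of_all _ fun _ => sq_nonneg _)).symm
    _ = ENNReal.ofReal (∫ p, ∫ q, K q p ∂(P.prod volume) ∂(l.prod l)) := by
        rw [integral_integral_swap hK]
    _ ≤ ‖∫ p, ∫ q, K q p ∂(P.prod volume) ∂(l.prod l)‖ₑ := Real.ofReal_le_enorm _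
    _ ≤ ∫⁻ p, ‖∫ q, K q p ∂(P.prod volume)‖ₑ ∂(l.prod l) := enorm_integral_le_lintegral_enorm _
    _ ≤ _ := by
        simp only [hKdef]
        rw [hl, Measure.prod_restrict, ← Measure.volume_eq_prod]
        exact lintegral_mono_set (prod_mono Ioc_subset_Icc_self Ioc_subset_Icc_self)

/-- This bound uses only the size and support of the kernel. It is the one applied at large scales,
and it also gives the finiteness needed for the absorption argument. -/
theorem exists_shellEnergy_le_sq (P : Measure Ω) [IsProbabilityMeasure P] (d k : ℕ) :
    ∃ C : ℝ≥0, ∀ X : ℝ → Ω → EuclideanSpace ℝ (Fin d), (∀ u, Measurable (X u)) →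
      (∀ x, Continuous fun u => X u x) → ∀ c e r : ℝ, c ≤ e → 0 < r →
      shellEnergy P X k c e r ≤ C * ENNReal.ofReal (r ^ (d : ℝ)) * ENNReal.ofReal ((e - c) ^ 2) := by
  set v := volume (Metric.ball (0 : EuclideanSpace ℝ (Fin d)) 1) with hv
  have hvt : v ≠ ∞ := measure_ball_lt_top.ne
  refine ⟨(sbeBound k ^ 2).toNNReal * v.toNNReal, fun X hX hc c e r hce hr => ?_⟩
  refine (shellEnergy_le_lintegral hX hc k hce hr).trans ?_
  calc _ ≤ ∫⁻ _p in Icc c e ×ˢ Icc c e, ENNReal.ofReal (sbeBound k ^ 2) *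
          (ENNReal.ofReal (r ^ (d : ℝ)) * v) ∂(volume : Measure (ℝ × ℝ)) :=
        lintegral_mono fun p => (enorm_integral_le_lintegral_enorm _).trans
          (lintegral_enorm_shellKernel_mul_le k hr (hX p.1) (hX p.2))
    _ = _ := by
        rw [setLIntegral_const, Measure.volume_eq_prod, Measure.prod_prod, Real.volume_Icc,
          ENNReal.ofReal_pow (sub_nonneg.2 hce), ENNReal.ofReal]
        push_cast
        rw [ENNReal.coe_toNNReal hvt]
        ring

theorem exists_shellEnergy_le_of_holder (P : Measure Ω) [IsProbabilityMeasure P] (d : ℕ) {β : ℝ}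
    (hβ : 0 ≤ β) {k : ℕ} (hk : d + ⌊β⌋₊ ≤ k) (C : ℝ≥0) :
    ∃ C' : ℝ≥0, ∀ X : ℝ → Ω → EuclideanSpace ℝ (Fin d), (∀ u, Measurable (X u)) →
      (∀ x, Continuous fun u => X u x) → ∀ c e : ℝ, c ≤ e →
      ∫⁻ p in Icc c e ×ˢ Icc c e,
          measureHolderENorm β (P.map fun x => X p.2 x - X p.1 x) ∂(volume : Measure (ℝ × ℝ))
        ≤ C * ENNReal.ofReal (e - c) → ∀ r, 0 < r →
      shellEnergy P X k c e r ≤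
        C' * ENNReal.ofReal (r ^ (2 * d + β)) * ENNReal.ofReal (e - c) := by
  obtain ⟨D, hD⟩ := exists_enorm_integral_shellKernel_mul_le (P := P) d hβ hk
  refine ⟨D * C, fun X hX hc c e hce h r hr => ?_⟩
  refine (shellEnergy_le_lintegral hX hc k hce hr).trans ?_
  have h1 : ∀ p : ℝ × ℝ, ‖∫ q, shellKernel k r (X p.1 q.1 - q.2) *
      shellKernel k r (X p.2 q.1 - q.2) ∂(P.prod volume)‖ₑ ≤
      D * ENNReal.ofReal (r ^ (2 * d + β)) *
        measureHolderENorm β (P.map fun x => X p.2 x - X p.1 x) :=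
    fun p => hD _ _ (hX p.1) (hX p.2) r hr
  calc _ ≤ ∫⁻ p in Icc c e ×ˢ Icc c e, D * ENNReal.ofReal (r ^ (2 * d + β)) *
        measureHolderENorm β (P.map fun x => X p.2 x - X p.1 x) := lintegral_mono h1
    _ = D * ENNReal.ofReal (r ^ (2 * d + β)) * ∫⁻ p in Icc c e ×ˢ Icc c e,
        measureHolderENorm β (P.map fun x => X p.2 x - X p.1 x) :=
      lintegral_const_mul' _ _ (ENNReal.mul_ne_top ENNReal.coe_ne_top ENNReal.ofReal_ne_top)
    _ ≤ D * ENNReal.ofReal (r ^ (2 * d + β)) * (C * ENNReal.ofReal (e - c)) := by gcongr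
    _ = _ := by
      push_cast
      ring

end SecondMoment

/-! ### Weighted radial integrals -/

theorem setLIntegral_Ioi_comp_two_mul {τ ε : ℝ} (hε : 0 ≤ ε) {Q : ℝ → ℝ≥0∞} (hQ : Measurable Q) :
    ∫⁻ r in Ioi ε, ENNReal.ofReal (r ^ (-τ - 1)) * Q (2 * r) =
      ENNReal.ofReal (2 ^ τ) * ∫⁻ r in Ioi (2 * ε), ENNReal.ofReal (r ^ (-τ - 1)) * Q r := by
  have hg : Measurable ((Ioi (2 * ε)).indicator fun r => ENNReal.ofReal (r ^ (-τ - 1)) * Q r) :=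
    Measurable.indicator (by fun_prop) measurableSet_Ioi
  have hg' : Measurable fun s : ℝ =>
      (Ioi (2 * ε)).indicator (fun r => ENNReal.ofReal (r ^ (-τ - 1)) * Q r) (2 * s) :=
    hg.comp (by fun_prop)
  rw [← lintegral_indicator measurableSet_Ioi, ← lintegral_indicator measurableSet_Ioi]
  conv_rhs => rw [← Real.smul_map_volume_mul_left (two_ne_zero (α := ℝ))]
  rw [lintegral_smul_measure, lintegral_map hg (by fun_prop), smul_eq_mul, ← mul_assoc,
    ← ENNReal.ofReal_mul (by positivity), abs_of_pos (two_pos (α := ℝ)),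
    ← lintegral_const_mul _ hg']
  refine lintegral_congr fun r => ?_
  by_cases h : ε < r
  · have hr : 0 < r := hε.trans_lt h
    rw [indicator_of_mem (show r ∈ Ioi ε from h),
      indicator_of_mem (show 2 * r ∈ Ioi (2 * ε) by simpa using h), ← mul_assoc,
      ← ENNReal.ofReal_mul (by positivity), Real.mul_rpow two_pos.le hr.le]
    congr 2
    have : (2 : ℝ) ^ τ * 2 * 2 ^ (-τ - 1) = 1 := by
      rw [← Real.rpow_add_one two_ne_zero, ← Real.rpow_add two_pos]
      simp
    rw [← mul_assoc, this, one_mul]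
  · rw [indicator_of_notMem (show r ∉ Ioi ε from h),
      indicator_of_notMem (show 2 * r ∉ Ioi (2 * ε) by simpa using h), mul_zero]

theorem ENNReal.le_mul_of_le_mul_self_add {x y θ : ℝ≥0∞} (hx : x ≠ ∞) (hθ : θ < 1)
    (h : x ≤ θ * x + y) : x ≤ (1 - θ)⁻¹ * y := by
  have h1 : (1 - θ) * x ≤ y := by
    rw [ENNReal.sub_mul (fun _ _ => hx), one_mul]
    exact tsub_le_iff_left.2 h
  rw [mul_comm, ← div_eq_mul_inv, ENNReal.le_div_iff_mul_le (Or.inl (tsub_pos_of_lt hθ).ne')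
    (Or.inl (ENNReal.sub_ne_top ENNReal.one_ne_top)), mul_comm]
  exact h1

theorem setLIntegral_Ioi_rpow {p R : ℝ} (hp : 0 < p) (hR : 0 < R) :
    ∫⁻ r in Ioi R, ENNReal.ofReal (r ^ (-p - 1)) = ENNReal.ofReal (R ^ (-p) / p) := by
  rw [← ofReal_integral_eq_lintegral_ofReal (integrableOn_Ioi_rpow_of_lt (by linarith) hR)
    ((ae_restrict_iff' measurableSet_Ioi).2 (ae_of_all _ fun r hr =>
      Real.rpow_nonneg (hR.trans hr).le _)), integral_Ioi_rpow_of_lt (by linarith) hR]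
  congr 1
  rw [sub_add_cancel, neg_div_neg_eq]

theorem setLIntegral_Ioc_rpow {p R : ℝ} (hp : 0 < p) (hR : 0 < R) :
    ∫⁻ r in Ioc 0 R, ENNReal.ofReal (r ^ (p - 1)) = ENNReal.ofReal (R ^ p / p) := by
  rw [← ofReal_integral_eq_lintegral_ofReal
    ((intervalIntegral.intervalIntegrable_rpow' (by linarith)).1)
    ((ae_restrict_iff' measurableSet_Ioc).2 (ae_of_all _ fun r hr => Real.rpow_nonneg hr.1.le _)),
    ← intervalIntegral.integral_of_le hR.le, integral_rpow (Or.inl (by linarith))]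
  congr 1
  rw [sub_add_cancel, Real.zero_rpow hp.ne', sub_zero]

/-- A weighted Hardy type inequality: a function that is controlled by a strict contraction of its
dilation, up to an error, is controlled by the error. -/
theorem setLIntegral_Ioi_zero_le_of_dilation {τ σ : ℝ} (hστ : σ < τ) {a b B : ℝ≥0∞}
    (ha : a * ENNReal.ofReal (2 ^ τ) < 1) (hB : B ≠ ∞) {Q₀ Q₁ : ℝ → ℝ≥0∞} (h₀ : Measurable Q₀)
    (h₁ : Measurable Q₁) (hQ : ∀ r, 0 < r → Q₀ r ≤ a * Q₀ (2 * r) + b * Q₁ (2 * r))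
    (hQB : ∀ r, 0 < r → Q₀ r ≤ B * ENNReal.ofReal (r ^ σ)) :
    ∫⁻ r in Ioi 0, ENNReal.ofReal (r ^ (-τ - 1)) * Q₀ r ≤
      (1 - a * ENNReal.ofReal (2 ^ τ))⁻¹ * (b * ENNReal.ofReal (2 ^ τ)) *
        ∫⁻ r in Ioi 0, ENNReal.ofReal (r ^ (-τ - 1)) * Q₁ r := by
  -- Absorption requires a finite left side: cutting at ε provides it, through the growth bound with
  -- σ < τ. Dilation moves the cut to 2ε, which only shrinks the domain, so the estimate closes
  -- uniformly in ε.
  have key : ∀ ε : ℝ, 0 < ε → ∫⁻ r in Ioi ε, ENNReal.ofReal (r ^ (-τ - 1)) * Q₀ r ≤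
      (1 - a * ENNReal.ofReal (2 ^ τ))⁻¹ * (b * ENNReal.ofReal (2 ^ τ)) *
        ∫⁻ r in Ioi 0, ENNReal.ofReal (r ^ (-τ - 1)) * Q₁ r := by
    intro ε hε
    rw [mul_assoc]
    refine ENNReal.le_mul_of_le_mul_self_add ?_ ha ?_
    · refine ne_top_of_le_ne_top (b := B * ENNReal.ofReal (ε ^ (-(τ - σ)) / (τ - σ)))
        (ENNReal.mul_ne_top hB ENNReal.ofReal_ne_top) ?_
      rw [← setLIntegral_Ioi_rpow (sub_pos.2 hστ) hε, ← lintegral_const_mul _ (by fun_prop)]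
      refine setLIntegral_mono (by fun_prop) fun r hr => ?_
      have hr0 : 0 < r := hε.trans hr
      calc _ ≤ ENNReal.ofReal (r ^ (-τ - 1)) * (B * ENNReal.ofReal (r ^ σ)) := by
            gcongr; exact hQB r hr0
        _ = B * (ENNReal.ofReal (r ^ (-τ - 1)) * ENNReal.ofReal (r ^ σ)) := by ring
        _ = _ := by
            rw [← ENNReal.ofReal_mul (by positivity), ← Real.rpow_add hr0]
            ring_nf
    · calc ∫⁻ r in Ioi ε, ENNReal.ofReal (r ^ (-τ - 1)) * Q₀ r
          ≤ ∫⁻ r in Ioi ε, (a * (ENNReal.ofReal (r ^ (-τ - 1)) * Q₀ (2 * r)) +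
              b * (ENNReal.ofReal (r ^ (-τ - 1)) * Q₁ (2 * r))) := by
            refine setLIntegral_mono (by fun_prop) fun r hr => ?_
            calc _ ≤ ENNReal.ofReal (r ^ (-τ - 1)) * (a * Q₀ (2 * r) + b * Q₁ (2 * r)) := by
                  gcongr; exact hQ r (hε.trans hr)
              _ = _ := by ring
        _ = a * (ENNReal.ofReal (2 ^ τ) * ∫⁻ r in Ioi (2 * ε),
              ENNReal.ofReal (r ^ (-τ - 1)) * Q₀ r) +
            b * (ENNReal.ofReal (2 ^ τ) * ∫⁻ r in Ioi (2 * ε),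
              ENNReal.ofReal (r ^ (-τ - 1)) * Q₁ r) := by
            rw [lintegral_add_left (by fun_prop), lintegral_const_mul _ (by fun_prop),
              lintegral_const_mul _ (by fun_prop), setLIntegral_Ioi_comp_two_mul hε.le h₀,
              setLIntegral_Ioi_comp_two_mul hε.le h₁]
        _ ≤ a * (ENNReal.ofReal (2 ^ τ) * ∫⁻ r in Ioi ε,
              ENNReal.ofReal (r ^ (-τ - 1)) * Q₀ r) +
            b * (ENNReal.ofReal (2 ^ τ) * ∫⁻ r in Ioi 0,
              ENNReal.ofReal (r ^ (-τ - 1)) * Q₁ r) := by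
            gcongr <;> linarith
        _ = _ := by ring
  have hU : Ioi (0 : ℝ) = ⋃ n : ℕ, Ioi (1 / ((n : ℝ) + 1)) := by
    ext r
    simp only [mem_Ioi, mem_iUnion]
    exact ⟨fun h => exists_nat_one_div_lt h, fun ⟨n, hn⟩ => lt_trans (by positivity) hn⟩
  rw [show (∫⁻ r in Ioi 0, ENNReal.ofReal (r ^ (-τ - 1)) * Q₀ r) =
    ∫⁻ r in ⋃ n : ℕ, Ioi (1 / ((n : ℝ) + 1)), ENNReal.ofReal (r ^ (-τ - 1)) * Q₀ r by rw [← hU],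
    setLIntegral_iUnion_of_directed]
  · exact iSup_le fun n => key _ (by positivity)
  · refine directed_of_isDirected_le fun m n hmn => Ioi_subset_Ioi ?_
    exact one_div_le_one_div_of_le (by positivity) (by gcongr)

/-- Interpolation between two power bounds. -/
theorem setLIntegral_Ioi_zero_le_of_two_bounds {τ σ₀ σ₁ : ℝ} (h0 : σ₀ < τ) (h1 : τ < σ₁)
    (A₀ A₁ : ℝ≥0) : ∃ C : ℝ≥0, ∀ (Q : ℝ → ℝ≥0∞) (h : ℝ), 0 < h →
    (∀ r, 0 < r → Q r ≤ A₀ * ENNReal.ofReal (r ^ σ₀) * ENNReal.ofReal (h ^ 2)) →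
    (∀ r, 0 < r → Q r ≤ A₁ * ENNReal.ofReal (r ^ σ₁) * ENNReal.ofReal h) →
    ∫⁻ r in Ioi 0, ENNReal.ofReal (r ^ (-τ - 1)) * Q r ≤
      C * ENNReal.ofReal (h ^ (1 + (σ₁ - τ) / (σ₁ - σ₀))) := by
  have hs : 0 < σ₁ - σ₀ := by linarith
  have hs1 : 0 < σ₁ - τ := by linarith
  have hs0 : 0 < τ - σ₀ := by linarith
  refine ⟨A₁ * (σ₁ - τ)⁻¹.toNNReal + A₀ * (τ - σ₀)⁻¹.toNNReal, fun Q h hh hQ0 hQ1 => ?_⟩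
  -- The scale at which r^σ₀ h² and r^σ₁ h agree.
  set R := h ^ (1 / (σ₁ - σ₀)) with hRdef
  have hR : 0 < R := Real.rpow_pos_of_pos hh _
  have bound : ∀ (A : ℝ≥0) (σ c r : ℝ), 0 < r → Q r ≤ A * ENNReal.ofReal (r ^ σ) * ENNReal.ofReal c →
      ENNReal.ofReal (r ^ (-τ - 1)) * Q r ≤
        (A * ENNReal.ofReal c) * ENNReal.ofReal (r ^ (σ - τ - 1)) := by
    intro A σ c r hr hq
    calc _ ≤ ENNReal.ofReal (r ^ (-τ - 1)) * (A * ENNReal.ofReal (r ^ σ) * ENNReal.ofReal c) := by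
          gcongr
      _ = (A * ENNReal.ofReal c) * (ENNReal.ofReal (r ^ (-τ - 1)) * ENNReal.ofReal (r ^ σ)) := by
          ring
      _ = _ := by
          rw [← ENNReal.ofReal_mul (by positivity), ← Real.rpow_add hr]
          ring_nf
  rw [← Ioc_union_Ioi_eq_Ioi hR.le, lintegral_union measurableSet_Ioi Ioc_disjoint_Ioi_same]
  push_cast
  rw [add_mul]
  refine add_le_add ?_ ?_
  · calc _ ≤ ∫⁻ r in Ioc 0 R, (A₁ * ENNReal.ofReal h) * ENNReal.ofReal (r ^ (σ₁ - τ - 1)) :=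
          setLIntegral_mono (by fun_prop) fun r hr => bound _ _ _ _ hr.1 (hQ1 r hr.1)
      _ = A₁ * (ENNReal.ofReal h * ENNReal.ofReal (R ^ (σ₁ - τ) / (σ₁ - τ))) := by
          rw [lintegral_const_mul _ (by fun_prop), setLIntegral_Ioc_rpow hs1 hR, mul_assoc]
      _ = _ := by
          rw [mul_assoc, ← ENNReal.ofReal_mul hh.le]
          congr 1
          change _ = ENNReal.ofReal _ * _
          rw [← ENNReal.ofReal_mul (by positivity), Real.rpow_add hh, Real.rpow_one, hRdef,
            ← Real.rpow_mul hh.le]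
          congr 1
          rw [one_div_mul_eq_div]
          ring
  · calc _ ≤ ∫⁻ r in Ioi R, (A₀ * ENNReal.ofReal (h ^ 2)) *
            ENNReal.ofReal (r ^ (-(τ - σ₀) - 1)) := by
          refine setLIntegral_mono (by fun_prop) fun r hr => ?_
          rw [neg_sub]
          exact bound _ _ _ _ (hR.trans hr) (hQ0 r (hR.trans hr))
      _ = A₀ * (ENNReal.ofReal (h ^ 2) * ENNReal.ofReal (R ^ (-(τ - σ₀)) / (τ - σ₀))) := by
          rw [lintegral_const_mul _ (by fun_prop), setLIntegral_Ioi_rpow hs0 hR, mul_assoc]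
      _ = _ := by
          rw [mul_assoc, ← ENNReal.ofReal_mul (by positivity)]
          congr 1
          change _ = ENNReal.ofReal _ * _
          rw [← ENNReal.ofReal_mul (by positivity), hRdef, ← Real.rpow_mul hh.le]
          congr 1
          have : h ^ (1 + (σ₁ - τ) / (σ₁ - σ₀)) = h ^ 2 * h ^ (1 / (σ₁ - σ₀) * -(τ - σ₀)) := by
            rw [← Real.rpow_natCast h 2, ← Real.rpow_add hh]
            congr 1
            field_simp
            push_cast
            ring
          rw [this]
          ring

/-! ### The `SBE` norm of occupation measures along a path -/

section Path

variable {d : ℕ} {w : ℝ → EuclideanSpace ℝ (Fin d)}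

theorem intervalIntegrable_shellKernel (hw : Continuous w) (k : ℕ) (r : ℝ)
    (y : EuclideanSpace ℝ (Fin d)) (s t : ℝ) :
    IntervalIntegrable (fun u => shellKernel k r (w u - y)) volume s t := by
  have hm : Measurable fun u => shellKernel k r (w u - y) :=
    (measurable_shellKernel_right k r).comp (by fun_prop)
  have h : IntervalIntegrable (fun _ : ℝ => sbeBound k) volume s t := by simp
  refine h.mono_fun hm.aestronglyMeasurable (ae_of_all _ fun u => ?_)
  simp only [Real.norm_eq_abs]
  exact (abs_shellKernel_le_bound k r _).trans (le_abs_self _)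

theorem occShell_succ (hw : Continuous w) (k : ℕ) (s t r : ℝ) (y : EuclideanSpace ℝ (Fin d)) :
    occShell k w s t r y =
      (2 ^ (k + 1))⁻¹ * (occShell k w s t (2 * r) y - occShell (k + 1) w s t (2 * r) y) := by
  simp only [occShell]
  rw [← intervalIntegral.integral_sub (intervalIntegrable_shellKernel hw _ _ _ _ _)
    (intervalIntegrable_shellKernel hw _ _ _ _ _), ← intervalIntegral.integral_const_mul]
  simp only [← shellKernel_succ]

theorem occShell_add (hw : Continuous w) (k : ℕ) (s t u r : ℝ) (y : EuclideanSpace ℝ (Fin d)) :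
    occShell k w s t r y + occShell k w t u r y = occShell k w s u r y :=
  intervalIntegral.integral_add_adjacent_intervals (intervalIntegrable_shellKernel hw _ _ _ _ _)
    (intervalIntegrable_shellKernel hw _ _ _ _ _)

theorem continuous_occShell (hw : Continuous w) (k : ℕ) (s r : ℝ) (y : EuclideanSpace ℝ (Fin d)) :
    Continuous fun t => occShell k w s t r y :=
  intervalIntegral.continuous_primitive (intervalIntegrable_shellKernel hw k r y) s

end Path

/-! ### Joint measurability of the shell transform -/

section Measurability

variable {Ω : Type*} [MeasurableSpace Ω] {d : ℕ} {X : ℝ → Ω → EuclideanSpace ℝ (Fin d)}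

theorem measurable_occShell (hX : ∀ u, Measurable (X u)) (hc : ∀ x, Continuous fun u => X u x)
    (k : ℕ) (s t : ℝ) :
    Measurable fun z : (Ω × EuclideanSpace ℝ (Fin d)) × ℝ =>
      occShell k (fun u => X u z.1.1) s t z.2 z.1.2 := by
  have hm := measurable_uncurry_path hX hc
  have h1 : Measurable fun p : ((Ω × EuclideanSpace ℝ (Fin d)) × ℝ) × ℝ =>
      shellKernel k p.1.2 (X p.2 p.1.1.1 - p.1.1.2) := by
    refine (measurable_shellKernel k).comp (Measurable.prodMk (by fun_prop) ?_)
    exact (hm.comp (f := fun p : ((Ω × EuclideanSpace ℝ (Fin d)) × ℝ) × ℝ => (p.2, p.1.1.1))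
      (by fun_prop)).sub (by fun_prop)
  simp only [occShell, intervalIntegral]
  exact (h1.stronglyMeasurable.integral_prod_right').measurable.sub
    (h1.stronglyMeasurable.integral_prod_right').measurable

theorem measurable_occShell_path {w : ℝ → EuclideanSpace ℝ (Fin d)} (hw : Continuous w)
    (k : ℕ) (s t : ℝ) :
    Measurable fun z : EuclideanSpace ℝ (Fin d) × ℝ => occShell k w s t z.2 z.1 :=
  (measurable_occShell (X := fun u (_ : Unit) => w u) (fun _ => measurable_const) (fun _ => hw)
    k s t).comp (f := fun z : EuclideanSpace ℝ (Fin d) × ℝ => (((), z.1), z.2)) (by fun_prop)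

end Measurability

instance : SFinite radialMeasure := by
  unfold radialMeasure
  infer_instance

/-- The `SBE` norm, with differences of order `k`, of the occupation measure of `w` on `(s, t]`. -/
noncomputable def pathNorm {d : ℕ} (α : ℝ) (k : ℕ) (w : ℝ → EuclideanSpace ℝ (Fin d)) (s t : ℝ) :
    ℝ≥0∞ :=
  eLpNorm (fun z : EuclideanSpace ℝ (Fin d) × ℝ => z.2 ^ (-α - d) * occShell k w s t z.2 z.1) 2
    (volume.prod radialMeasure)

section PathNorm

variable {d : ℕ} {w : ℝ → EuclideanSpace ℝ (Fin d)}

theorem measurable_weight_mul_occShell (hw : Continuous w) (α : ℝ) (k : ℕ) (s t : ℝ) :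
    Measurable fun z : EuclideanSpace ℝ (Fin d) × ℝ =>
      z.2 ^ (-α - d) * occShell k w s t z.2 z.1 :=
  Measurable.mul (by fun_prop) (measurable_occShell_path hw k s t)

theorem pathNorm_self (α : ℝ) (k : ℕ) (s : ℝ) : pathNorm α k w s s = 0 := by
  simp [pathNorm, occShell]

theorem pathNorm_comm (α : ℝ) (k : ℕ) (s t : ℝ) : pathNorm α k w s t = pathNorm α k w t s := by
  rw [pathNorm, pathNorm, ← eLpNorm_neg]
  congr 1
  ext z
  simp only [Pi.neg_apply, occShell]
  rw [intervalIntegral.integral_symm, mul_neg, neg_neg]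

theorem pathNorm_triangle (hw : Continuous w) (α : ℝ) (k : ℕ) (s t u : ℝ) :
    pathNorm α k w s u ≤ pathNorm α k w s t + pathNorm α k w t u := by
  refine le_trans (le_of_eq ?_) (eLpNorm_add_le
    (measurable_weight_mul_occShell hw α k s t).aestronglyMeasurable
    (measurable_weight_mul_occShell hw α k t u).aestronglyMeasurable one_le_two)
  rw [pathNorm]
  congr 1
  ext z
  simp only [Pi.add_apply]
  rw [← mul_add, occShell_add hw]

/-- Fatou: the shell transform is continuous in the end point for each fixed radius and centre. This
extends bounds from dyadic times to all times. -/
theorem pathNorm_le_of_tendsto (hw : Continuous w) (α : ℝ) (k : ℕ) {s t : ℝ} {u : ℕ → ℝ}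
    (hu : Filter.Tendsto u Filter.atTop (nhds t)) {B : ℝ≥0∞}
    (hB : ∀ n, pathNorm α k w s (u n) ≤ B) : pathNorm α k w s t ≤ B := by
  refine (Lp.eLpNorm_lim_le_liminf_eLpNorm
    (f := fun n (z : EuclideanSpace ℝ (Fin d) × ℝ) =>
      z.2 ^ (-α - d) * occShell k w s (u n) z.2 z.1)
    (fun n => (measurable_weight_mul_occShell hw α k s (u n)).aestronglyMeasurable) _
    (ae_of_all _ fun z => ?_)).trans ?_
  · exact (((continuous_occShell hw k s z.2 z.1).tendsto t).comp hu).const_mul _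
  · refine (Filter.liminf_le_liminf (Filter.Eventually.of_forall hB)).trans (le_of_eq ?_)
    exact Filter.liminf_const B

theorem lintegral_radialMeasure {g : ℝ → ℝ≥0∞} (hg : Measurable g) :
    ∫⁻ r, g r ∂radialMeasure = ∫⁻ r in Ioi 0, ENNReal.ofReal r⁻¹ * g r := by
  rw [radialMeasure, lintegral_withDensity_eq_lintegral_mul _ (by fun_prop) hg]
  rfl

theorem ofReal_inv_mul_enorm_rpow_mul_sq {r : ℝ} (hr : 0 < r) (κ c : ℝ) :
    ENNReal.ofReal r⁻¹ * ‖r ^ (-κ) * c‖ₑ ^ 2 =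
      ENNReal.ofReal (r ^ (-(2 * κ) - 1)) * ‖c‖ₑ ^ 2 := by
  rw [enorm_mul, mul_pow, ← mul_assoc, Real.enorm_of_nonneg (by positivity),
    ← ENNReal.ofReal_pow (by positivity), ← ENNReal.ofReal_mul (by positivity)]
  congr 2
  rw [← Real.rpow_natCast, ← Real.rpow_mul hr.le, ← Real.rpow_neg_one, ← Real.rpow_add hr]
  congr 1
  push_cast
  ring

theorem eLpNorm_two_sq {X E : Type*} [MeasurableSpace X] {m : Measure X} [TopologicalSpace E]
    [ESeminormedAddMonoid E] (f : X → E) :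
    eLpNorm f 2 m ^ 2 = ∫⁻ x, ‖f x‖ₑ ^ 2 ∂m := by
  have := eLpNorm_nnreal_pow_eq_lintegral (f := f) (μ := m) (p := 2) two_ne_zero
  simpa using this

theorem pathNorm_sq (hw : Continuous w) (α : ℝ) (k : ℕ) (s t : ℝ) :
    pathNorm α k w s t ^ 2 = ∫⁻ y, ∫⁻ r in Ioi 0,
      ENNReal.ofReal (r ^ (-(2 * (α + d)) - 1)) * ‖occShell k w s t r y‖ₑ ^ 2 := by
  have hm := measurable_weight_mul_occShell hw α k s t
  rw [pathNorm, eLpNorm_two_sq, lintegral_prod _ (hm.enorm.pow_const 2).aemeasurable]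
  refine lintegral_congr fun y => ?_
  rw [lintegral_radialMeasure (g := fun r => ‖r ^ (-α - d) * occShell k w s t r y‖ₑ ^ 2)
    (((hm.comp measurable_prodMk_left).enorm).pow_const 2)]
  refine setLIntegral_congr_fun measurableSet_Ioi fun r hr => ?_
  rw [← ofReal_inv_mul_enorm_rpow_mul_sq hr, neg_add']

/-- For p = q = 2 the mixed norm is an L² norm on the product, by Tonelli applied to the squares.
Only r > 0 matters, since the radial measure lives there. -/
theorem sbeENorm_eq_pathNorm (hw : Continuous w) (α : ℝ) (s t : ℝ)
    {μ : SignedMeasure (EuclideanSpace ℝ (Fin d))}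
    (hμ : ∀ y r, 0 < r → sbeDelta ⌈α + d - 1⌉₊ (fun ρ => ballMass μ ρ y) r =
      occShell ⌈α + d - 1⌉₊ w s t r y) :
    sbeENorm α 2 2 μ = pathNorm α ⌈α + d - 1⌉₊ w s t := by
  have hsq : sbeENorm α 2 2 μ ^ 2 = pathNorm α ⌈α + d - 1⌉₊ w s t ^ 2 := by
    rw [sbeENorm, pathNorm, eLpNorm_two_sq, eLpNorm_two_sq,
      lintegral_prod _ ((measurable_weight_mul_occShell hw α _ s t).enorm.pow_const 2).aemeasurable]
    refine lintegral_congr fun y => ?_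
    rw [enorm_eq_self, eLpNorm_two_sq]
    refine lintegral_congr_ae ?_
    rw [radialMeasure]
    refine (withDensity_absolutelyContinuous _ _).ae_le ?_
    refine (ae_restrict_iff' measurableSet_Ioi).2 (ae_of_all _ fun r hr => ?_)
    simp only
    rw [hμ y r hr]
  exact (ENNReal.pow_right_strictMono two_ne_zero).injective hsq

end PathNorm

/-! ### Second moments of the path norm, scale by scale -/

section Moment

variable {Ω : Type*} [MeasurableSpace Ω] {P : Measure Ω} {d : ℕ}
  {X : ℝ → Ω → EuclideanSpace ℝ (Fin d)}

theorem measurable_pathNorm_sq (hX : ∀ u, Measurable (X u)) (hc : ∀ x, Continuous fun u => X u x)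
    (α : ℝ) (k : ℕ) (s t : ℝ) : Measurable fun x => pathNorm α k (fun u => X u x) s t ^ 2 := by
  have hm := measurable_occShell hX hc k s t
  simp only [pathNorm_sq (hc _)]
  refine Measurable.lintegral_prod_right' (f := fun p : Ω × EuclideanSpace ℝ (Fin d) =>
    ∫⁻ r in Ioi 0, ENNReal.ofReal (r ^ (-(2 * (α + d)) - 1)) *
      ‖occShell k (fun u => X u p.1) s t r p.2‖ₑ ^ 2) ?_
  exact Measurable.lintegral_prod_right'
    (f := fun z : (Ω × EuclideanSpace ℝ (Fin d)) × ℝ =>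
      ENNReal.ofReal (z.2 ^ (-(2 * (α + d)) - 1)) *
      ‖occShell k (fun u => X u z.1.1) s t z.2 z.1.2‖ₑ ^ 2) (by fun_prop)

theorem measurable_shellEnergy [SFinite P] (hX : ∀ u, Measurable (X u)) (hc : ∀ x, Continuous fun u => X u x)
    (k : ℕ) (s t : ℝ) : Measurable (shellEnergy P X k s t) := by
  have hm := measurable_occShell hX hc k s t
  exact Measurable.lintegral_prod_left' (f := fun z : (Ω × EuclideanSpace ℝ (Fin d)) × ℝ =>
      ‖occShell k (fun u => X u z.1.1) s t z.2 z.1.2‖ₑ ^ 2) (by fun_prop)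

theorem lintegral_pathNorm_sq [SFinite P] (hX : ∀ u, Measurable (X u)) (hc : ∀ x, Continuous fun u => X u x)
    (α : ℝ) (k : ℕ) (s t : ℝ) :
    ∫⁻ x, pathNorm α k (fun u => X u x) s t ^ 2 ∂P =
      ∫⁻ r in Ioi 0, ENNReal.ofReal (r ^ (-(2 * (α + d)) - 1)) * shellEnergy P X k s t r := by
  have hm := measurable_occShell hX hc k s t
  have hm2 : Measurable fun z : (Ω × EuclideanSpace ℝ (Fin d)) × ℝ =>
      ENNReal.ofReal (z.2 ^ (-(2 * (α + d)) - 1)) *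
      ‖occShell k (fun u => X u z.1.1) s t z.2 z.1.2‖ₑ ^ 2 := by fun_prop
  simp only [pathNorm_sq (hc _)]
  rw [← lintegral_prod (fun p : Ω × EuclideanSpace ℝ (Fin d) =>
    ∫⁻ r in Ioi 0, ENNReal.ofReal (r ^ (-(2 * (α + d)) - 1)) *
      ‖occShell k (fun u => X u p.1) s t r p.2‖ₑ ^ 2)
    (Measurable.lintegral_prod_right' hm2).aemeasurable, lintegral_lintegral_swap hm2.aemeasurable]
  refine lintegral_congr fun r => ?_
  exact lintegral_const_mul _ ((hm.comp measurable_prodMk_right).enorm.pow_const 2)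

/-- The first coefficient can be made as close to 1 as desired; a fixed factor 2 would destroy the
contraction when τ is close to 2(k+1). -/
theorem enorm_sub_sq_le {δ : ℝ} (hδ : 0 < δ) (u v : ℝ) :
    ‖u - v‖ₑ ^ 2 ≤ ENNReal.ofReal (1 + δ) * ‖u‖ₑ ^ 2 + ENNReal.ofReal (1 + δ⁻¹) * ‖v‖ₑ ^ 2 := by
  have h : ∀ x : ℝ, ‖x‖ₑ ^ 2 = ENNReal.ofReal (x ^ 2) := fun x => by
    rw [← ofReal_norm, ← ENNReal.ofReal_pow (norm_nonneg _), Real.norm_eq_abs, sq_abs]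
  rw [h, h, h, ← ENNReal.ofReal_mul (by positivity), ← ENNReal.ofReal_mul (by positivity),
    ← ENNReal.ofReal_add (by positivity) (by positivity)]
  refine ENNReal.ofReal_le_ofReal ?_
  have : (1 + δ) * u ^ 2 + (1 + δ⁻¹) * v ^ 2 - (u - v) ^ 2 = δ⁻¹ * (δ * u + v) ^ 2 := by
    field_simp
    ring
  have h2 : 0 ≤ δ⁻¹ * (δ * u + v) ^ 2 := by positivity
  linarith

theorem shellEnergy_le_dilation (hX : ∀ u, Measurable (X u))
    (hc : ∀ x, Continuous fun u => X u x) {δ : ℝ} (hδ : 0 < δ) (k : ℕ) (s t r : ℝ) :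
    shellEnergy P X k s t r ≤
      ENNReal.ofReal ((4 ^ (k + 1))⁻¹ * (1 + δ)) * shellEnergy P X k s t (2 * r) +
      ENNReal.ofReal ((4 ^ (k + 1))⁻¹ * (1 + δ⁻¹)) * shellEnergy P X (k + 1) s t (2 * r) := by
  have hm : ∀ j, Measurable fun q : Ω × EuclideanSpace ℝ (Fin d) =>
      ‖occShell j (fun u => X u q.1) s t (2 * r) q.2‖ₑ ^ 2 := fun j =>
    ((measurable_occShell hX hc j s t).comp
      (f := fun q : Ω × EuclideanSpace ℝ (Fin d) => (q, 2 * r)) (by fun_prop)).enorm.pow_const 2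
  simp only [shellEnergy]
  rw [← lintegral_const_mul _ (hm _), ← lintegral_const_mul _ (hm _),
    ← lintegral_add_left ((hm _).const_mul _)]
  refine lintegral_mono fun q => ?_
  rw [occShell_succ (hc q.1), enorm_mul, mul_pow]
  refine (mul_le_mul_right (enorm_sub_sq_le hδ _ _) _).trans (le_of_eq ?_)
  have h4 : ‖((2 : ℝ) ^ (k + 1))⁻¹‖ₑ ^ 2 = ENNReal.ofReal (4 ^ (k + 1))⁻¹ := by
    rw [Real.enorm_of_nonneg (by positivity), ← ENNReal.ofReal_pow (by positivity), inv_pow,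
      ← pow_mul, mul_comm, pow_mul]
    norm_num
  rw [h4, ENNReal.ofReal_mul (by positivity), ENNReal.ofReal_mul (by positivity)]
  ring

end Moment

/-! ### Moment bounds for the `SBE` norm of occupation measures -/

section MomentBound

variable {Ω : Type*} [MeasurableSpace Ω]

theorem exists_setLIntegral_shellEnergy_le_succ (P : Measure Ω) [IsProbabilityMeasure P] {d k : ℕ}
    {τ : ℝ} (hdτ : d < τ) (hτ : τ < 2 * (k + 1)) :
    ∃ C : ℝ≥0, ∀ X : ℝ → Ω → EuclideanSpace ℝ (Fin d), (∀ u, Measurable (X u)) →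
      (∀ x, Continuous fun u => X u x) → ∀ c e : ℝ, c ≤ e →
      ∫⁻ r in Ioi 0, ENNReal.ofReal (r ^ (-τ - 1)) * shellEnergy P X k c e r ≤
        C * ∫⁻ r in Ioi 0, ENNReal.ofReal (r ^ (-τ - 1)) * shellEnergy P X (k + 1) c e r := by
  obtain ⟨B, hB⟩ := exists_shellEnergy_le_sq P d k
  -- The squared gain of the recursion times the cost of the dilation r ↦ 2r in the weighted
  -- integral; it is below 1 because τ < 2(k+1).
  set q : ℝ := (4 ^ (k + 1))⁻¹ * 2 ^ τ with hq
  have hq0 : 0 < q := by positivity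
  have hq1 : q < 1 := by
    rw [hq, inv_mul_lt_one₀ (by positivity), show (4 : ℝ) = 2 ^ (2 : ℝ) by norm_num,
      ← Real.rpow_natCast, ← Real.rpow_mul two_pos.le]
    refine Real.rpow_lt_rpow_of_exponent_lt one_lt_two ?_
    push_cast
    exact hτ
  -- With this choice q(1 + δ) = (1 + q)/2 < 1.
  set δ : ℝ := (1 - q) / (2 * q) with hδdef
  have hδ : 0 < δ := div_pos (by linarith) (by linarith)
  have hθ : ENNReal.ofReal ((4 ^ (k + 1))⁻¹ * (1 + δ)) * ENNReal.ofReal (2 ^ τ) < 1 := by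
    rw [← ENNReal.ofReal_mul (by positivity), ENNReal.ofReal_lt_one]
    have : (4 ^ (k + 1))⁻¹ * (1 + δ) * 2 ^ τ = q * (1 + δ) := by rw [hq]; ring
    rw [this, hδdef]
    field_simp
    linarith
  set b := ENNReal.ofReal ((4 ^ (k + 1))⁻¹ * (1 + δ⁻¹))
  set D := (1 - ENNReal.ofReal ((4 ^ (k + 1))⁻¹ * (1 + δ)) * ENNReal.ofReal (2 ^ τ))⁻¹ *
    (b * ENNReal.ofReal (2 ^ τ))
  have hD : D ≠ ∞ := ENNReal.mul_ne_top (ENNReal.inv_ne_top.2 (tsub_pos_of_lt hθ).ne')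
    (ENNReal.mul_ne_top ENNReal.ofReal_ne_top ENNReal.ofReal_ne_top)
  refine ⟨D.toNNReal, fun X hX hc c e hce => ?_⟩
  rw [ENNReal.coe_toNNReal hD]
  refine setLIntegral_Ioi_zero_le_of_dilation hdτ (B := B * ENNReal.ofReal ((e - c) ^ 2)) hθ
    (ENNReal.mul_ne_top ENNReal.coe_ne_top ENNReal.ofReal_ne_top)
    (measurable_shellEnergy hX hc k c e) (measurable_shellEnergy hX hc (k + 1) c e)
    (fun r _ => shellEnergy_le_dilation hX hc hδ k c e r) fun r hr => ?_
  refine (hB X hX hc c e r hce hr).trans (le_of_eq ?_)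
  ring

theorem exists_setLIntegral_shellEnergy_le_add (P : Measure Ω) [IsProbabilityMeasure P] {d k : ℕ}
    {τ : ℝ} (hdτ : d < τ) (hτ : τ < 2 * (k + 1)) (j : ℕ) :
    ∃ C : ℝ≥0, ∀ X : ℝ → Ω → EuclideanSpace ℝ (Fin d), (∀ u, Measurable (X u)) →
      (∀ x, Continuous fun u => X u x) → ∀ c e : ℝ, c ≤ e →
      ∫⁻ r in Ioi 0, ENNReal.ofReal (r ^ (-τ - 1)) * shellEnergy P X k c e r ≤
        C * ∫⁻ r in Ioi 0, ENNReal.ofReal (r ^ (-τ - 1)) * shellEnergy P X (k + j) c e r := by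
  induction j with
  | zero => exact ⟨1, fun X _ _ c e _ => by simp⟩
  | succ j ih =>
    obtain ⟨C, hC⟩ := ih
    obtain ⟨D, hD⟩ := exists_setLIntegral_shellEnergy_le_succ P (k := k + j) hdτ
      (by push_cast; have : (0 : ℝ) ≤ j := j.cast_nonneg; linarith)
    refine ⟨C * D, fun X hX hc c e hce => (hC X hX hc c e hce).trans ?_⟩
    push_cast
    rw [mul_assoc]
    gcongr
    exact hD X hX hc c e hce

theorem exists_lintegral_pathNorm_sq_le (P : Measure Ω) [IsProbabilityMeasure P] {d k : ℕ}
    {α β : ℝ} (hα : 0 < α) (hαβ : 2 * α < β) (hk : α + d < k + 1) (C : ℝ≥0) :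
    ∃ C' : ℝ≥0, ∀ X : ℝ → Ω → EuclideanSpace ℝ (Fin d), (∀ u, Measurable (X u)) →
      (∀ x, Continuous fun u => X u x) → ∀ c e : ℝ, c < e →
      ∫⁻ p in Icc c e ×ˢ Icc c e,
          measureHolderENorm β (P.map fun x => X p.2 x - X p.1 x) ∂(volume : Measure (ℝ × ℝ))
        ≤ C * ENNReal.ofReal (e - c) →
      ∫⁻ x, pathNorm α k (fun u => X u x) c e ^ 2 ∂P ≤
        C' * ENNReal.ofReal ((e - c) ^ (1 + (β - 2 * α) / (β + d))) := by
  have hβ : 0 ≤ β := by linarith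
  have hd : (0 : ℝ) ≤ d := d.cast_nonneg
  -- The weight exponent 2(α+d) comes from squaring r^(-α-d). Raising the order by d + ⌊β⌋ suffices
  -- for the Taylor argument, whatever k is.
  obtain ⟨D, hD⟩ := exists_setLIntegral_shellEnergy_le_add P (d := d) (k := k)
    (τ := 2 * (α + d)) (by linarith) (by linarith) (d + ⌊β⌋₊)
  obtain ⟨A₀, hA₀⟩ := exists_shellEnergy_le_sq P d (k + (d + ⌊β⌋₊))
  obtain ⟨A₁, hA₁⟩ := exists_shellEnergy_le_of_holder P d hβ (k := k + (d + ⌊β⌋₊)) (by omega) C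
  obtain ⟨B, hB⟩ := setLIntegral_Ioi_zero_le_of_two_bounds (τ := 2 * (α + d)) (σ₀ := d)
    (σ₁ := 2 * d + β) (by linarith) (by linarith) A₀ A₁
  refine ⟨D * B, fun X hX hc c e hce h => ?_⟩
  rw [lintegral_pathNorm_sq hX hc]
  refine (hD X hX hc c e hce.le).trans ?_
  push_cast
  rw [mul_assoc]
  gcongr
  refine (hB _ (e - c) (sub_pos.2 hce) (fun r hr => hA₀ X hX hc c e r hce.le hr)
    fun r hr => hA₁ X hX hc c e hce.le h r hr).trans (le_of_eq ?_)
  congr 4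
  congr 1 <;> ring

end MomentBound

/-! ### Dyadic chaining -/

/-- The left end point of the dyadic interval of generation `n` of `[a, a + L]` containing `t`. -/
noncomputable def dyadicFloor (a L : ℝ) (n : ℕ) (t : ℝ) : ℝ :=
  a + ⌊(t - a) / L * 2 ^ n⌋₊ * (L / 2 ^ n)

theorem tendsto_dyadicFloor {a L t : ℝ} (hL : 0 < L) (ht : a ≤ t) :
    Filter.Tendsto (fun n => dyadicFloor a L n t) Filter.atTop (nhds t) := by
  have h1 : Filter.Tendsto (fun n : ℕ => (⌊(t - a) / L * 2 ^ n⌋₊ : ℝ) / 2 ^ n) Filter.atTop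
      (nhds ((t - a) / L)) :=
    (tendsto_nat_floor_mul_div_atTop (div_nonneg (sub_nonneg.2 ht) hL.le)).comp
      (tendsto_pow_atTop_atTop_of_one_lt one_lt_two)
  have h2 := (h1.mul_const L).const_add a
  rw [div_mul_cancel₀ _ hL.ne', add_sub_cancel] at h2
  refine h2.congr fun n => ?_
  rw [dyadicFloor]
  ring

/-- A chaining bound: a lower semicontinuous family of distances that decays geometrically along
dyadic intervals is Hölder continuous. -/
theorem le_of_dyadic_chaining {a L γ : ℝ} (hL : 0 < L) (hγ : 0 < γ) {N : ℝ → ℝ → ℝ≥0∞}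
    (hself : ∀ s, N s s = 0) (hcomm : ∀ s t, N s t = N t s)
    (htri : ∀ s t u, N s u ≤ N s t + N t u)
    (hlsc : ∀ s t (u : ℕ → ℝ), Filter.Tendsto u Filter.atTop (nhds t) → ∀ B,
      (∀ n, N s (u n) ≤ B) → N s t ≤ B)
    {S : ℝ≥0}
    (hS : ∀ n i : ℕ, i < 2 ^ n → N (a + i * (L / 2 ^ n)) (a + (i + 1) * (L / 2 ^ n)) ≤
      S * ENNReal.ofReal ((2 ^ (-γ)) ^ n)) :
    ∃ C : ℝ≥0, ∀ s ∈ Icc a (a + L), ∀ t ∈ Icc a (a + L),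
      N s t ≤ C * ENNReal.ofReal (|t - s| ^ γ) := by
  set q : ℝ := 2 ^ (-γ) with hq
  have hq0 : 0 < q := by positivity
  have hq1 : q < 1 := Real.rpow_lt_one_of_one_lt_of_neg one_lt_two (neg_lt_zero.2 hγ)
  have hfloor_le : ∀ t ∈ Icc a (a + L), ∀ n : ℕ, ⌊(t - a) / L * 2 ^ n⌋₊ ≤ 2 ^ n := by
    intro t ht n
    refine Nat.floor_le_of_le ?_
    push_cast
    refine mul_le_of_le_one_left (by positivity) ((div_le_one hL).2 ?_)
    linarith [ht.2]
  have hstep : ∀ t ∈ Icc a (a + L), ∀ n : ℕ,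
      N (dyadicFloor a L n t) (dyadicFloor a L (n + 1) t) ≤ S * ENNReal.ofReal (q ^ (n + 1)) := by
    intro t ht n
    have hx : 0 ≤ (t - a) / L := div_nonneg (sub_nonneg.2 ht.1) hL.le
    have hle := hfloor_le t ht (n + 1)
    have h0 : 0 ≤ (t - a) / L * 2 ^ n := by positivity
    have h2 : (t - a) / L * 2 ^ (n + 1) = 2 * ((t - a) / L * 2 ^ n) := by ring
    have hn : dyadicFloor a L n t =
        a + (2 * ⌊(t - a) / L * 2 ^ n⌋₊ : ℕ) * (L / 2 ^ (n + 1)) := by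
      rw [dyadicFloor, pow_succ]
      push_cast
      field_simp
    -- Refining the grid either keeps the approximating point or moves it by one interval of the
    -- finer generation.
    have hcase : ⌊(t - a) / L * 2 ^ (n + 1)⌋₊ = 2 * ⌊(t - a) / L * 2 ^ n⌋₊ ∨
        ⌊(t - a) / L * 2 ^ (n + 1)⌋₊ = 2 * ⌊(t - a) / L * 2 ^ n⌋₊ + 1 := by
      have l1 : 2 * ⌊(t - a) / L * 2 ^ n⌋₊ ≤ ⌊(t - a) / L * 2 ^ (n + 1)⌋₊ := by
        refine Nat.le_floor ?_
        push_cast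
        linarith [Nat.floor_le h0]
      have l2 : ⌊(t - a) / L * 2 ^ (n + 1)⌋₊ < 2 * ⌊(t - a) / L * 2 ^ n⌋₊ + 2 := by
        refine (Nat.floor_lt (by positivity)).2 ?_
        push_cast
        linarith [Nat.lt_floor_add_one ((t - a) / L * 2 ^ n)]
      omega
    rcases hcase with h | h
    · have : dyadicFloor a L (n + 1) t = dyadicFloor a L n t := by
        rw [hn, dyadicFloor, h]
      rw [this, hself]
      exact zero_le
    · rw [hn, dyadicFloor, h]
      have := hS (n + 1) (2 * ⌊(t - a) / L * 2 ^ n⌋₊) (by omega)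
      rw [Nat.cast_add_one]
      exact this
  -- The factor (1 - q^j)/(1 - q) is the partial geometric sum, in the form that makes the induction
  -- on j close.
  have hchain : ∀ t ∈ Icc a (a + L), ∀ n j : ℕ,
      N (dyadicFloor a L n t) (dyadicFloor a L (n + j) t) ≤
        S * ENNReal.ofReal (q ^ n * (1 - q)⁻¹ * (1 - q ^ j)) := by
    intro t ht n j
    induction j with
    | zero => simp [hself]
    | succ j ih =>
      refine (htri _ _ _).trans ((add_le_add ih (hstep t ht (n + j))).trans ?_)
      have hqj : q ^ j ≤ 1 := pow_le_one₀ hq0.le hq1.le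
      have h1q : 0 < (1 - q)⁻¹ := inv_pos.2 (sub_pos.2 hq1)
      rw [← mul_add, ← ENNReal.ofReal_add (mul_nonneg (by positivity) (sub_nonneg.2 hqj))
        (by positivity)]
      gcongr
      have h3 : q ^ n * (1 - q)⁻¹ * (1 - q ^ (j + 1)) =
          q ^ n * (1 - q)⁻¹ * (1 - q ^ j) + q ^ (n + j) := by
        have : (1 - q) ≠ 0 := (sub_pos.2 hq1).ne'
        field_simp
        ring
      rw [h3]
      exact add_le_add le_rfl (pow_le_pow_of_le_one hq0.le hq1.le (Nat.le_succ _))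
  have hlim : ∀ t ∈ Icc a (a + L), ∀ n : ℕ,
      N (dyadicFloor a L n t) t ≤ S * ENNReal.ofReal (q ^ n * (1 - q)⁻¹) := by
    intro t ht n
    refine hlsc _ t (fun j => dyadicFloor a L (n + j) t) ?_ _ fun j => (hchain t ht n j).trans ?_
    · exact (tendsto_dyadicFloor hL ht.1).comp (Filter.tendsto_add_atTop_nat n |>.congr
        fun j => add_comm _ _)
    · refine mul_le_mul' le_rfl (ENNReal.ofReal_le_ofReal ?_)
      refine mul_le_of_le_one_right ?_ ?_
      · have := sub_pos.2 hq1
        positivity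
      · have : 0 ≤ q ^ j := by positivity
        linarith
  have hmain : ∀ s ∈ Icc a (a + L), ∀ t ∈ Icc a (a + L), s < t →
      N s t ≤ (S * (2 * (1 - q)⁻¹ + 1) * (2 / L) ^ γ).toNNReal *
        ENNReal.ofReal (|t - s| ^ γ) := by
    intro s hs t ht hst
    have h1q : 0 < (1 - q)⁻¹ := inv_pos.2 (sub_pos.2 hq1)
    have hts : 0 < (t - s) / L := div_pos (sub_pos.2 hst) hL
    have hts1 : (t - s) / L ≤ 1 := (div_le_one hL).2 (by linarith [hs.1, ht.2])
    -- The generation n satisfies 2^(-(n+1)) < (t-s)/L ≤ 2^(-n): the grid points below s and t are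
    -- then equal or adjacent, and q^n is comparable to |t-s|^γ.
    obtain ⟨n, hn1, hn2⟩ := exists_nat_pow_near_of_lt_one hts hts1
      (y := (2 : ℝ)⁻¹) (by norm_num) (by norm_num)
    have hmid : N (dyadicFloor a L n s) (dyadicFloor a L n t) ≤ S * ENNReal.ofReal (q ^ n) := by
      have hsub : (t - a) / L * 2 ^ n = (s - a) / L * 2 ^ n + (t - s) / L * 2 ^ n := by ring
      have hle1 : (t - s) / L * 2 ^ n ≤ 1 := by
        rw [inv_pow] at hn2
        calc (t - s) / L * 2 ^ n ≤ (2 ^ n)⁻¹ * 2 ^ n := by gcongr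
          _ = 1 := inv_mul_cancel₀ (by positivity)
      have hs0 : 0 ≤ (s - a) / L * 2 ^ n :=
        mul_nonneg (div_nonneg (sub_nonneg.2 hs.1) hL.le) (by positivity)
      have hpos : 0 < (t - s) / L * 2 ^ n := by positivity
      have hcase : ⌊(t - a) / L * 2 ^ n⌋₊ = ⌊(s - a) / L * 2 ^ n⌋₊ ∨
          ⌊(t - a) / L * 2 ^ n⌋₊ = ⌊(s - a) / L * 2 ^ n⌋₊ + 1 := by
        have l1 : ⌊(s - a) / L * 2 ^ n⌋₊ ≤ ⌊(t - a) / L * 2 ^ n⌋₊ :=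
          Nat.floor_le_floor (by linarith)
        have l2 : ⌊(t - a) / L * 2 ^ n⌋₊ < ⌊(s - a) / L * 2 ^ n⌋₊ + 2 := by
          refine (Nat.floor_lt (by linarith)).2 ?_
          push_cast
          linarith [Nat.lt_floor_add_one ((s - a) / L * 2 ^ n)]
        omega
      rcases hcase with h | h
      · rw [dyadicFloor, dyadicFloor, h, hself]
        exact zero_le
      · rw [dyadicFloor, dyadicFloor, h, Nat.cast_add_one]
        refine hS n _ ?_
        have := hfloor_le t ht n
        omega
    have hqn : q ^ n ≤ (2 / L) ^ γ * |t - s| ^ γ := by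
      rw [abs_of_pos (sub_pos.2 hst), ← Real.mul_rpow (by positivity) (sub_pos.2 hst).le, hq,
        ← Real.rpow_natCast, ← Real.rpow_mul two_pos.le, show -γ * (n : ℝ) = -(n : ℝ) * γ by ring,
        Real.rpow_mul two_pos.le]
      refine Real.rpow_le_rpow (by positivity) ?_ hγ.le
      rw [Real.rpow_neg two_pos.le, Real.rpow_natCast, ← inv_pow]
      rw [pow_succ] at hn1
      have : 2 / L * (t - s) = 2 * ((t - s) / L) := by ring
      rw [this]
      linarith
    calc N s t ≤ N s (dyadicFloor a L n s) + N (dyadicFloor a L n s) t := htri _ _ _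
      _ ≤ N (dyadicFloor a L n s) s +
          (N (dyadicFloor a L n s) (dyadicFloor a L n t) + N (dyadicFloor a L n t) t) := by
          rw [hcomm s]
          gcongr
          exact htri _ _ _
      _ ≤ S * ENNReal.ofReal (q ^ n * (1 - q)⁻¹) + (S * ENNReal.ofReal (q ^ n) +
          S * ENNReal.ofReal (q ^ n * (1 - q)⁻¹)) :=
          add_le_add (hlim s hs n) (add_le_add hmid (hlim t ht n))
      _ = ENNReal.ofReal (S * (2 * (1 - q)⁻¹ + 1) * q ^ n) := by
          rw [← mul_add, ← mul_add, ← ENNReal.ofReal_add (by positivity) (by positivity),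
            ← ENNReal.ofReal_add (by positivity) (by positivity), ← ENNReal.ofReal_coe_nnreal,
            ← ENNReal.ofReal_mul (by positivity)]
          congr 1
          ring
      _ ≤ ENNReal.ofReal (S * (2 * (1 - q)⁻¹ + 1) * (2 / L) ^ γ * |t - s| ^ γ) := by
          rw [mul_assoc _ _ (|t - s| ^ γ)]
          gcongr
      _ = _ := ENNReal.ofReal_mul (by positivity)
  refine ⟨(S * (2 * (1 - q)⁻¹ + 1) * (2 / L) ^ γ).toNNReal, fun s hs t ht => ?_⟩
  rcases lt_trichotomy s t with h | h | h
  · exact hmain s hs t ht h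
  · rw [h, hself]
    exact zero_le
  · rw [hcomm, abs_sub_comm]
    exact hmain t ht s hs h

/-! ### Almost sure Hölder continuity -/

section Kolmogorov

variable {Ω : Type*} [MeasurableSpace Ω] {P : Measure Ω} {d : ℕ}
  {X : ℝ → Ω → EuclideanSpace ℝ (Fin d)}

/-- Kolmogorov's criterion with second moments: the weighted sum of squared norms over all dyadic
intervals has finite expectation, hence is almost surely finite, and it dominates each of its terms.
-/
theorem ae_exists_pathNorm_le (hX : ∀ u, Measurable (X u)) (hc : ∀ x, Continuous fun u => X u x)
    {a L α ρ γ : ℝ} (hL : 0 < L) (hγ : 0 < γ) (hγρ : 2 * γ < ρ) (k : ℕ) {C : ℝ≥0}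
    (hC : ∀ c e, a ≤ c → c < e → e ≤ a + L → ∫⁻ x, pathNorm α k (fun u => X u x) c e ^ 2 ∂P ≤
      C * ENNReal.ofReal ((e - c) ^ (1 + ρ))) :
    ∀ᵐ x ∂P, ∃ D : ℝ≥0, ∀ s ∈ Icc a (a + L), ∀ t ∈ Icc a (a + L),
      pathNorm α k (fun u => X u x) s t ≤ D * ENNReal.ofReal (|t - s| ^ γ) := by
  let N : ℕ → ℕ → Ω → ℝ≥0∞ := fun n i x =>
    pathNorm α k (fun u => X u x) (a + i * (L / 2 ^ n)) (a + (i + 1) * (L / 2 ^ n))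
  have hN : ∀ n i, Measurable fun x => N n i x ^ 2 := fun n i =>
    measurable_pathNorm_sq hX hc α k _ _
  set q : ℝ := 2 ^ (-γ) with hq
  have hq0 : 0 < q := by positivity
  set Z : Ω → ℝ≥0∞ := fun x => ∑' n : ℕ, ∑ i ∈ Finset.range (2 ^ n),
    ENNReal.ofReal ((q ^ n)⁻¹ ^ 2) * N n i x ^ 2 with hZ
  have hZm : Measurable Z := Measurable.tsum fun n =>
    Finset.measurable_fun_sum _ fun i _ => (hN n i).const_mul _
  -- Generation n contributes 2^n intervals, the weight 2^(2γn) and the moment (L 2^(-n))^(1+ρ), in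
  -- total L^(1+ρ) θ^n.
  set θ : ℝ := 2 ^ (2 * γ - ρ) with hθ
  have hθ1 : θ < 1 := Real.rpow_lt_one_of_one_lt_of_neg one_lt_two (by linarith)
  have hterm : ∀ n : ℕ, ∑ i ∈ Finset.range (2 ^ n),
      ENNReal.ofReal ((q ^ n)⁻¹ ^ 2) * ∫⁻ x, N n i x ^ 2 ∂P ≤
      C * ENNReal.ofReal (L ^ (1 + ρ)) * ENNReal.ofReal θ ^ n := by
    intro n
    have hstep : (0 : ℝ) < L / 2 ^ n := by positivity
    have h1 : ∀ i ∈ Finset.range (2 ^ n), ENNReal.ofReal ((q ^ n)⁻¹ ^ 2) * ∫⁻ x, N n i x ^ 2 ∂P ≤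
        ENNReal.ofReal ((q ^ n)⁻¹ ^ 2) * (C * ENNReal.ofReal ((L / 2 ^ n) ^ (1 + ρ))) := by
      intro i hi
      have hi' : (i : ℝ) + 1 ≤ 2 ^ n := by
        exact_mod_cast Nat.succ_le_of_lt (Finset.mem_range.1 hi)
      gcongr
      refine (hC _ _ (le_add_of_nonneg_right (by positivity)) ?_ ?_).trans (le_of_eq ?_)
      · nlinarith
      · have : ((i : ℝ) + 1) * (L / 2 ^ n) ≤ 2 ^ n * (L / 2 ^ n) := by gcongr
        rw [mul_div_cancel₀ _ (by positivity)] at this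
        linarith
      · congr 3
        ring
    refine (Finset.sum_le_sum h1).trans (le_of_eq ?_)
    rw [Finset.sum_const, Finset.card_range, nsmul_eq_mul]
    have h2 : (((2 ^ n : ℕ) : ℝ≥0∞)) = ENNReal.ofReal (2 ^ n) := by
      rw [← ENNReal.ofReal_natCast]
      push_cast
      rfl
    have h3 : (2 : ℝ) ^ n * ((q ^ n)⁻¹ ^ 2 * (L / 2 ^ n) ^ (1 + ρ)) = L ^ (1 + ρ) * θ ^ n := by
      rw [Real.div_rpow hL.le (by positivity), hq, hθ]
      simp only [← Real.rpow_natCast, ← Real.rpow_mul two_pos.le, ← Real.rpow_neg two_pos.le]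
      rw [div_eq_mul_inv, ← Real.rpow_neg two_pos.le]
      calc _ = L ^ (1 + ρ) * ((2 : ℝ) ^ (n : ℝ) * ((2 : ℝ) ^ (-(-γ * (n : ℝ)) * ((2 : ℕ) : ℝ)) *
            2 ^ (-((n : ℝ) * (1 + ρ))))) := by ring
        _ = _ := by
          rw [← Real.rpow_add two_pos, ← Real.rpow_add two_pos]
          congr 2
          push_cast
          ring
    calc _ = C * (ENNReal.ofReal (2 ^ n) * (ENNReal.ofReal ((q ^ n)⁻¹ ^ 2) *
          ENNReal.ofReal ((L / 2 ^ n) ^ (1 + ρ)))) := by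
          rw [h2]
          ring
      _ = _ := by
          rw [← ENNReal.ofReal_mul (by positivity), ← ENNReal.ofReal_mul (by positivity), h3,
            ENNReal.ofReal_mul (by positivity), ENNReal.ofReal_pow (by positivity), mul_assoc]
  have hZint : ∫⁻ x, Z x ∂P ≠ ∞ := by
    have h1 : ∫⁻ x, Z x ∂P = ∑' n : ℕ, ∑ i ∈ Finset.range (2 ^ n),
        ENNReal.ofReal ((q ^ n)⁻¹ ^ 2) * ∫⁻ x, N n i x ^ 2 ∂P := by
      rw [hZ, lintegral_tsum fun n => (Finset.measurable_fun_sum _ fun i _ =>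
        (hN n i).const_mul _).aemeasurable]
      refine tsum_congr fun n => ?_
      rw [lintegral_finsetSum _ fun i _ => (hN n i).const_mul _]
      exact Finset.sum_congr rfl fun i _ => lintegral_const_mul _ (hN n i)
    rw [h1]
    refine ne_top_of_le_ne_top ?_ (ENNReal.tsum_le_tsum hterm)
    rw [ENNReal.tsum_mul_left, ENNReal.tsum_geometric]
    refine ENNReal.mul_ne_top (ENNReal.mul_ne_top ENNReal.coe_ne_top ENNReal.ofReal_ne_top)
      (ENNReal.inv_ne_top.2 (tsub_pos_of_lt ?_).ne')
    exact ENNReal.ofReal_lt_one.2 hθ1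
  filter_upwards [ae_lt_top hZm hZint] with x hx
  refine le_of_dyadic_chaining hL hγ (pathNorm_self α k) (pathNorm_comm α k)
    (pathNorm_triangle (hc x) α k) (fun s t u hu B hB => pathNorm_le_of_tendsto (hc x) α k hu hB)
    -- Adding 1 avoids a square root, since Z ≤ (Z + 1)².
    (S := (Z x).toNNReal + 1) fun n i hi => ?_
  refine (ENNReal.pow_right_strictMono two_ne_zero).le_iff_le.1 ?_
  have h1 : ENNReal.ofReal ((q ^ n)⁻¹ ^ 2) * N n i x ^ 2 ≤ Z x :=
    (Finset.single_le_sum (f := fun i => ENNReal.ofReal ((q ^ n)⁻¹ ^ 2) * N n i x ^ 2)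
      (fun _ _ => zero_le) (Finset.mem_range.2 hi)).trans
      (ENNReal.le_tsum (f := fun n => ∑ i ∈ Finset.range (2 ^ n),
        ENNReal.ofReal ((q ^ n)⁻¹ ^ 2) * N n i x ^ 2) n)
  calc N n i x ^ 2
      = ENNReal.ofReal ((q ^ n) ^ 2) * (ENNReal.ofReal ((q ^ n)⁻¹ ^ 2) * N n i x ^ 2) := by
        rw [← mul_assoc, ← ENNReal.ofReal_mul (by positivity), ← mul_pow,
          mul_inv_cancel₀ (by positivity), one_pow, ENNReal.ofReal_one, one_mul]
    _ ≤ ENNReal.ofReal ((q ^ n) ^ 2) * Z x := by gcongr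
    _ ≤ ENNReal.ofReal ((q ^ n) ^ 2) * (((Z x).toNNReal + 1 : ℝ≥0) : ℝ≥0∞) ^ 2 := by
        gcongr
        push_cast
        rw [ENNReal.coe_toNNReal hx.ne]
        calc Z x ≤ Z x + 1 := le_self_add
          _ = (Z x + 1) * 1 := (mul_one _).symm
          _ ≤ (Z x + 1) * (Z x + 1) := by gcongr; exact le_add_self
          _ = _ := (sq _).symm
    _ = _ := by
        rw [mul_pow, ENNReal.ofReal_pow (by positivity), mul_comm]

end Kolmogorov

/-! ### Occupation measures -/

section Occupation

variable {d : ℕ} {w : ℝ → EuclideanSpace ℝ (Fin d)}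

theorem measurableSet_norm_sub_le (hw : Continuous w) (y : EuclideanSpace ℝ (Fin d)) (ρ : ℝ) :
    MeasurableSet {u | ‖w u - y‖ ≤ ρ} :=
  measurableSet_le (by fun_prop) measurable_const

theorem integrable_ite_norm_sub_le (hw : Continuous w) (y : EuclideanSpace ℝ (Fin d)) (ρ : ℝ)
    (m : Measure ℝ) [IsFiniteMeasure m] :
    Integrable (fun u => if ‖w u - y‖ ≤ ρ then (1 : ℝ) else 0) m :=
  (integrable_const (1 : ℝ)).indicator (measurableSet_norm_sub_le hw y ρ)

theorem ballMass_occupationMeasure (hw : Continuous w) {a t : ℝ} (hat : a ≤ t) (ρ : ℝ)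
    (y : EuclideanSpace ℝ (Fin d)) :
    ballMass (occupationMeasure w a t).toSignedMeasure ρ y =
      ∫ u in a..t, if ‖w u - y‖ ≤ ρ then (1 : ℝ) else 0 := by
  have hB : MeasurableSet (Metric.closedBall y ρ) := Metric.isClosed_closedBall.measurableSet
  have hS := measurableSet_norm_sub_le hw y ρ
  have hi : (fun u => if ‖w u - y‖ ≤ ρ then (1 : ℝ) else 0) =
      {u | ‖w u - y‖ ≤ ρ}.indicator fun _ => 1 := rfl
  rw [ballMass, Measure.toSignedMeasure_apply_measurable hB, occupationMeasure,
    map_measureReal_apply hw.measurable hB, intervalIntegral.integral_of_le hat, hi,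
    integral_indicator_const _ hS, smul_eq_mul, mul_one]
  congr 1

theorem ballMass_occupationMeasure_sub (hw : Continuous w) {a s t : ℝ} (has : a ≤ s) (hat : a ≤ t)
    (ρ : ℝ) (y : EuclideanSpace ℝ (Fin d)) :
    ballMass ((occupationMeasure w a t).toSignedMeasure -
      (occupationMeasure w a s).toSignedMeasure) ρ y =
      ∫ u in s..t, if ‖w u - y‖ ≤ ρ then (1 : ℝ) else 0 := by
  have h : ballMass ((occupationMeasure w a t).toSignedMeasure -
      (occupationMeasure w a s).toSignedMeasure) ρ y =
      ballMass (occupationMeasure w a t).toSignedMeasure ρ y -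
      ballMass (occupationMeasure w a s).toSignedMeasure ρ y := rfl
  rw [h, ballMass_occupationMeasure hw has, ballMass_occupationMeasure hw hat]
  refine intervalIntegral.integral_interval_sub_left ?_ ?_ <;>
  exact ⟨integrable_ite_norm_sub_le hw y ρ _, integrable_ite_norm_sub_le hw y ρ _⟩

theorem sbeDelta_intervalIntegral_eq_occShell (hw : Continuous w) (k : ℕ) (s t : ℝ) {r : ℝ}
    (hr : 0 < r) (y : EuclideanSpace ℝ (Fin d)) :
    sbeDelta k (fun ρ => ∫ u in s..t, if ‖w u - y‖ ≤ ρ then (1 : ℝ) else 0) r =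
      occShell k w s t r y := by
  simp only [occShell, intervalIntegral]
  rw [sbeDelta_sub, sbeDelta_integral _ _ (fun ρ _ => integrable_ite_norm_sub_le hw y ρ _) hr,
    sbeDelta_integral _ _ (fun ρ _ => integrable_ite_norm_sub_le hw y ρ _) hr]
  rfl

/-- The difference of occupation measures is an oriented time integral from s to t, so no order
between s and t is needed. -/
theorem sbeENorm_occupationMeasure_sub (hw : Continuous w) (α : ℝ) {a s t : ℝ} (has : a ≤ s)
    (hat : a ≤ t) :
    sbeENorm α 2 2 ((occupationMeasure w a t).toSignedMeasure -
      (occupationMeasure w a s).toSignedMeasure) = pathNorm α ⌈α + d - 1⌉₊ w s t := by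
  refine sbeENorm_eq_pathNorm hw α s t fun y r hr => ?_
  simp only [ballMass_occupationMeasure_sub hw has hat]
  exact sbeDelta_intervalIntegral_eq_occShell hw _ s t hr y

theorem sbeENorm_occupationMeasure (hw : Continuous w) (α : ℝ) {a t : ℝ} (hat : a ≤ t) :
    sbeENorm α 2 2 (occupationMeasure w a t).toSignedMeasure =
      pathNorm α ⌈α + d - 1⌉₊ w a t := by
  refine sbeENorm_eq_pathNorm hw α a t fun y r hr => ?_
  simp only [ballMass_occupationMeasure hw hat]
  exact sbeDelta_intervalIntegral_eq_occShell hw _ a t hr y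

theorem toSignedMeasure_occupationMeasure_apply_eq_zero (hw : Continuous w) {a b t : ℝ}
    (htb : t ≤ b) {A : Set (EuclideanSpace ℝ (Fin d))} (hA : Disjoint A (w '' Icc a b)) :
    (occupationMeasure w a t).toSignedMeasure A = 0 := by
  by_cases hm : MeasurableSet A
  · rw [Measure.toSignedMeasure_apply_measurable hm, measureReal_def, occupationMeasure,
      Measure.map_apply hw.measurable hm, Measure.restrict_apply (hw.measurable hm)]
    have : w ⁻¹' A ∩ Ioc a t = ∅ := by
      refine eq_empty_of_forall_notMem fun u hu => ?_
      exact disjoint_left.1 hA hu.1 ⟨u, ⟨hu.2.1.le, hu.2.2.trans htb⟩, rfl⟩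
    rw [this]
    simp
  · exact VectorMeasure.not_measurable _ hm

theorem occupationMeasure_congr {w w' : ℝ → EuclideanSpace ℝ (Fin d)} {a t : ℝ}
    (h : ∀ u ∈ Ioc a t, w u = w' u) : occupationMeasure w a t = occupationMeasure w' a t :=
  Measure.map_congr ((ae_restrict_iff' measurableSet_Ioc).2 (ae_of_all _ h))

theorem holderInSBE_of_pathNorm_le (hw : Continuous w) {a b α γ γ' : ℝ} (hab : a ≤ b)
    (hγ : 0 ≤ γ) (hγγ' : γ ≤ γ')
    {D : ℝ≥0} (hD : ∀ s ∈ Icc a b, ∀ t ∈ Icc a b,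
      pathNorm α ⌈α + d - 1⌉₊ w s t ≤ D * ENNReal.ofReal (|t - s| ^ γ')) :
    HolderInSBE α 2 2 γ a b fun t => (occupationMeasure w a t).toSignedMeasure := by
  refine ⟨fun t ht => ⟨⟨w '' Icc a b, isCompact_Icc.image hw, fun A hA =>
    toSignedMeasure_occupationMeasure_apply_eq_zero hw ht.2 hA⟩, ?_⟩,
    D * ((b - a) ^ (γ' - γ)).toNNReal, fun s hs t ht => ?_⟩
  · rw [sbeENorm_occupationMeasure hw α ht.1]
    exact (hD a (left_mem_Icc.2 hab) t ht).trans_lt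
      (ENNReal.mul_lt_top ENNReal.coe_lt_top ENNReal.ofReal_lt_top)
  · rw [sbeENorm_occupationMeasure_sub hw α hs.1 ht.1]
    refine (hD s hs t ht).trans ?_
    push_cast
    rw [mul_assoc]
    gcongr
    change _ ≤ ENNReal.ofReal _ * _
    rw [← ENNReal.ofReal_mul (Real.rpow_nonneg (sub_nonneg.2 hab) _)]
    refine ENNReal.ofReal_le_ofReal ?_
    rw [show γ' = (γ' - γ) + γ by ring,
      Real.rpow_add_of_nonneg (abs_nonneg _) (sub_nonneg.2 hγγ') hγ, add_sub_cancel_right]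
    gcongr
    exact abs_sub_le_iff.2 ⟨by linarith [hs.1, ht.2], by linarith [hs.2, ht.1]⟩

end Occupation

theorem corollary4p2
    {Ω : Type*} [MeasurableSpace Ω] (P : Measure Ω) [IsProbabilityMeasure P]
    (d : ℕ) (hd : 1 ≤ d) (a b : ℝ) (hab : a ≤ b)
    (ω : ℝ → Ω → EuclideanSpace ℝ (Fin d))
    (hmeas : ∀ t ∈ Icc a b, Measurable (ω t))
    (hcont : ∀ x, ContinuousOn (fun t => ω t x) (Icc a b))
    (β : ℝ) (hβ : 0 < β)
    (C : ℝ≥0)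
    (hC : ∀ c e : ℝ, a ≤ c → c ≤ e → e ≤ b →
      ∫⁻ p in Icc c e ×ˢ Icc c e,
          measureHolderENorm β (P.map fun x => ω p.2 x - ω p.1 x) ∂(volume : Measure (ℝ × ℝ))
        ≤ C * ENNReal.ofReal (e - c))
    (α : ℝ) (hα : 0 < α) (hαβ : α < β / 2) (hαN : ∀ n : ℕ, 2 * α ≠ n) :
    ∀ᵐ x ∂P, ∀ γ : ℝ, 0 < γ → γ < (β - 2 * α) / (2 * (β + 2 * d)) →
      HolderInSBE α 2 2 γ a b
        (fun t => (occupationMeasure (fun r => ω r x) a t).toSignedMeasure) := by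
  have hd' : (1 : ℝ) ≤ d := by exact_mod_cast hd
  -- Extending the paths by constants outside [a,b] makes them continuous and measurable at all real
  -- times without affecting the occupation measures in question.
  set X : ℝ → Ω → EuclideanSpace ℝ (Fin d) := fun u => ω (projIcc a b hab u) with hXdef
  have hX : ∀ u, Measurable (X u) := fun u => hmeas _ (projIcc a b hab u).2
  have hXc : ∀ x, Continuous fun u => X u x := fun x =>
    (continuousOn_iff_continuous_domRestrict.1 (hcont x)).comp continuous_projIcc
  have hXω : ∀ u ∈ Icc a b, X u = ω u := fun u hu => by rw [hXdef]; simp only [projIcc_of_mem hab hu]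
  set k := ⌈α + d - 1⌉₊ with hk
  have hk1 : α + d < k + 1 := by
    have h1 : α + d - 1 ≤ k := Nat.le_ceil _
    -- Equality would make α = k + 1 - d, hence 2α, an integer.
    refine lt_of_le_of_ne (by linarith) fun h => hαN (2 * (k + 1) - 2 * d) ?_
    have h2 : 2 * d ≤ 2 * (k + 1) := by
      have : (d : ℝ) ≤ k + 1 := by linarith
      have : d ≤ k + 1 := by exact_mod_cast this
      omega
    push_cast [Nat.cast_sub h2]
    linarith
  set ρ := (β - 2 * α) / (β + d) with hρ
  -- Restricting to rational exponents gives one null set for all of them; a real γ is then handled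
  -- through a larger rational exponent.
  have key : ∀ᵐ x ∂P, ∀ g : ℚ, 0 < (g : ℝ) → 2 * (g : ℝ) < ρ → ∃ D : ℝ≥0,
      ∀ s ∈ Icc a b, ∀ t ∈ Icc a b,
        pathNorm α k (fun u => X u x) s t ≤ D * ENNReal.ofReal (|t - s| ^ (g : ℝ)) := by
    rcases hab.eq_or_lt with rfl | hlt
    · refine ae_of_all _ fun x g _ _ => ⟨0, fun s hs t ht => ?_⟩
      rw [Icc_self, mem_singleton_iff] at hs ht
      rw [hs, ht, pathNorm_self]
      exact zero_le
    · obtain ⟨C', hC'⟩ := exists_lintegral_pathNorm_sq_le P (d := d) hα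
        (show 2 * α < β by linarith) hk1 C
      refine ae_all_iff.2 fun g => ?_
      by_cases hg : 0 < (g : ℝ) ∧ 2 * (g : ℝ) < ρ
      · have := ae_exists_pathNorm_le (P := P) hX hXc (a := a) (L := b - a) (α := α) (ρ := ρ)
          (γ := g) (sub_pos.2 hlt) hg.1 hg.2 k (C := C') fun c e hac hce heb => ?_
        · rw [add_sub_cancel] at this
          filter_upwards [this] with x hx _ _ using hx
        · rw [add_sub_cancel] at heb
          refine hC' X hX hXc c e hce (le_of_eq_of_le ?_ (hC c e hac hce.le heb))
          refine setLIntegral_congr_fun (measurableSet_Icc.prod measurableSet_Icc) fun p hp => ?_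
          rw [hXω p.1 ⟨hac.trans hp.1.1, hp.1.2.trans heb⟩,
            hXω p.2 ⟨hac.trans hp.2.1, hp.2.2.trans heb⟩]
      · exact ae_of_all _ fun x h1 h2 => absurd ⟨h1, h2⟩ hg
  filter_upwards [key] with x hx γ hγ0 hγ
  -- The moment bound has β + d in the denominator, where the claimed range has β + 2d.
  have hγρ : γ < ρ / 2 := by
    refine hγ.trans_le ?_
    rw [hρ, div_div, mul_comm (β + d) 2]
    have : 0 ≤ β - 2 * α := by linarith
    gcongr
    linarith
  obtain ⟨g, hg1, hg2⟩ := exists_rat_btwn hγρ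
  obtain ⟨D, hD⟩ := hx g (hγ0.trans hg1) (by linarith)
  have hH := holderInSBE_of_pathNorm_le (hXc x) hab hγ0.le hg1.le hD
  have heq : ∀ t ∈ Icc a b, (occupationMeasure (fun r => ω r x) a t).toSignedMeasure =
      (occupationMeasure (fun r => X r x) a t).toSignedMeasure := fun t ht =>
    Measure.toSignedMeasure_congr (occupationMeasure_congr fun u hu => by
      rw [hXω u ⟨hu.1.le, hu.2.trans ht.2⟩])
  refine ⟨fun t ht => ?_, hH.2.imp fun K hK s hs t ht => ?_⟩
  · beta_reduce
    rw [heq t ht]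
    exact hH.1 t ht
  · beta_reduce
    rw [heq t ht, heq s hs]
    exact hK s hs t ht
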